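/- \textbf{Setting.} A \emph{network} is a finite directed multigraph $G=(V,E)$ with two designated distinct nodes, a source $s$ and a sink $t$, such that every node and every edge lies on some simple directed $s$–$t$ path. The series composition $G_1\to G_2$ of two networks is obtained from their disjoint union by identifying the sink of $G_1$ with the source of $G_2$ (the new source is that of $G_1$, the new sink that of $G_2$). The parallel composition $G_1\parallel G_2$ is obtained by identifying the two sources (forming the new source) and identifying the two sinks (forming the new sink). $G$ is \emph{SPP} (a series of parallel paths) if, up to isomorphism, $G=G_1\to\cdots\to G_k$ for some $k\ge 1$, where each $G_i$ is a parallel composition of one or more simple paths, each with at least one edge. A \emph{capacitated cost-sharing game} on $G$ with $n$ agents consists of a source node and a sink node in $V$ for each agent, and of a cost $p_e\in\mathbb{R}_{\ge 0}$ and a capacity $c_e\in\mathbb{N}\cup\{0\}$ for every edge $e$. It is a \emph{single-source} game if all agents have the same source node; this may be any node of $G$, and the sinks may be arbitrary nodes that differ between agents. A strategy of an agent is a simple directed path from her source to her sink. For a profile $\sigma=(\sigma_1,\dots,\sigma_n)$ let $x_e(\sigma)=|\{i : e\in\sigma_i\}|$. The profile is feasible if $x_e(\sigma)\le c_e$ for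 every edge $e$, and a game is feasible if it has a feasible profile. The cost of agent $i$ is $p_i(\sigma)=\sum_{e\in\sigma_i}p_e/x_e(\sigma)$ if $\sigma$ is feasible, and $p_i(\sigma)=\infty$ otherwise. A profile $\sigma$ is a \emph{strong equilibrium} (SE) if for every nonempty coalition $C$ of agents and all strategies $\sigma'_C$ of its members there is $j\in C$ with $p_j(\sigma)\le p_j(\sigma'_C,\sigma_{-C})$. We say that $G$ \emph{admits an SE in single-source games} if every feasible single-source game on $G$, for every number of agents and all costs and capacities, has an SE. \textbf{Theorem.} A network $G$ admits an SE in single-source games if and only if $G$ is SPP. -/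

import Mathlib

open scoped NNReal ENNReal

universe u v u' v'

namespace CCS

/-- A network: a directed multigraph with a designated source `s` and sink `t`. -/
structure Network where
  /-- nodes -/
  V : Type u
  /-- edges -/
  E : Type v
  /-- tail of an edge -/
  src : E → V
  /-- head of an edge -/
  tgt : E → V
  /-- designated source -/
  s : V
  /-- designated sink -/
  t : V

namespace Network

/-- Isomorphism of networks, respecting the designated source and sink. -/
structure Iso (G : Network.{u, v}) (H : Network.{u', v'}) where
  /-- bijection of nodes -/
  onV : G.V ≃ H.V
  /-- bijection of edges -/
  onE : G.E ≃ H.E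
  src_comm : ∀ e, H.src (onE e) = onV (G.src e)
  tgt_comm : ∀ e, H.tgt (onE e) = onV (G.tgt e)
  map_s : onV G.s = H.s
  map_t : onV G.t = H.t

/-- `G.IsWalk x p y`: the list of edges `p` is a directed walk from `x` to `y`. -/
def IsWalk (G : Network.{u, v}) : G.V → List G.E → G.V → Prop
  | x, [], y => x = y
  | x, e :: p, y => G.src e = x ∧ G.IsWalk (G.tgt e) p y

/-- The nodes visited by a walk that starts at `x` and follows the edges `p`. -/
def nodes (G : Network.{u, v}) (x : G.V) (p : List G.E) : List G.V :=
  x :: p.map G.tgt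

/-- `G.IsPath x p y`: the list of edges `p` is a directed path from `x` to `y`,
i.e. a directed walk that repeats no node. -/
def IsPath (G : Network.{u, v}) (x : G.V) (p : List G.E) (y : G.V) : Prop :=
  G.IsWalk x p y ∧ (G.nodes x p).Nodup

/-- The source and the sink are distinct, and every node and every edge lies on some
(simple, directed) path from the source to the sink. -/
structure IsTwoTerminal (G : Network.{u, v}) : Prop where
  s_ne_t : G.s ≠ G.t
  node_mem : ∀ x : G.V, ∃ p, G.IsPath G.s p G.t ∧ x ∈ G.nodes G.s p
  edge_mem : ∀ e : G.E, ∃ p, G.IsPath G.s p G.t ∧ e ∈ p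

/-- Series composition: in the disjoint union, identify the sink of `G` with the source of `H`. -/
def series (G H : Network.{u, v}) : Network.{u, v} where
  V := Quot fun a b : G.V ⊕ H.V => a = Sum.inl G.t ∧ b = Sum.inr H.s
  E := G.E ⊕ H.E
  src := Sum.elim (fun e => Quot.mk _ (Sum.inl (G.src e))) (fun e => Quot.mk _ (Sum.inr (H.src e)))
  tgt := Sum.elim (fun e => Quot.mk _ (Sum.inl (G.tgt e))) (fun e => Quot.mk _ (Sum.inr (H.tgt e)))
  s := Quot.mk _ (Sum.inl G.s)
  t := Quot.mk _ (Sum.inr H.t)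

/-- Parallel composition: in the disjoint union, identify the two sources with each other,
and the two sinks with each other. -/
def parallel (G H : Network.{u, v}) : Network.{u, v} where
  V := Quot fun a b : G.V ⊕ H.V =>
    (a = Sum.inl G.s ∧ b = Sum.inr H.s) ∨ (a = Sum.inl G.t ∧ b = Sum.inr H.t)
  E := G.E ⊕ H.E
  src := Sum.elim (fun e => Quot.mk _ (Sum.inl (G.src e))) (fun e => Quot.mk _ (Sum.inr (H.src e)))
  tgt := Sum.elim (fun e => Quot.mk _ (Sum.inl (G.tgt e))) (fun e => Quot.mk _ (Sum.inr (H.tgt e)))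
  s := Quot.mk _ (Sum.inl G.s)
  t := Quot.mk _ (Sum.inl G.t)

/-- The network consisting of one simple path with `m + 1` edges, from its first to its
last node. -/
def pathNetwork (m : ℕ) : Network.{0, 0} where
  V := Fin (m + 2)
  E := Fin (m + 1)
  src := Fin.castSucc
  tgt := Fin.succ
  s := 0
  t := Fin.last (m + 1)

/-- The network is a simple path (with at least one edge) from its source to its sink. -/
def IsSimplePath (G : Network.{u, v}) : Prop :=
  ∃ m : ℕ, Nonempty (Iso G (pathNetwork m))

/-- The network is a parallel composition `P₁ ∥ ⋯ ∥ Pₗ` of `l ≥ 1` simple paths. -/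
def IsParallelPaths (G : Network.{u, v}) : Prop :=
  ∃ (P : Network.{u, v}) (L : List Network.{u, v}),
    (∀ Q ∈ P :: L, Q.IsSimplePath) ∧ Nonempty (Iso G (L.foldl parallel P))

/-- Series of parallel paths: the network is a series composition `G₁ → ⋯ → Gₖ`, `k ≥ 1`,
of parallel compositions of simple paths. -/
def IsSPP (G : Network.{u, v}) : Prop :=
  ∃ (G₁ : Network.{u, v}) (L : List Network.{u, v}),
    (∀ H ∈ G₁ :: L, H.IsParallelPaths) ∧ Nonempty (Iso G (L.foldl series G₁))

end Network

/-- A (possibly asymmetric) capacitated cost-sharing game with `n` agents on the network `G`. -/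
structure Game (G : Network.{u, v}) (n : ℕ) where
  /-- source node of each agent -/
  source : Fin n → G.V
  /-- sink node of each agent -/
  sink : Fin n → G.V
  /-- cost of each edge -/
  cost : G.E → ℝ≥0
  /-- capacity of each edge -/
  cap : G.E → ℕ

namespace Game

variable {G : Network.{u, v}} {n : ℕ}

/-- All agents have the same source node. -/
def IsSingleSource (Δ : Game G n) : Prop :=
  ∃ x : G.V, ∀ i, Δ.source i = x

/-- The strategies of an agent are the paths from her source to her sink. -/
def Strategy (Δ : Game G n) (i : Fin n) : Type v :=
  {p : List G.E // G.IsPath (Δ.source i) p (Δ.sink i)}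

/-- A strategy profile. -/
def Profile (Δ : Game G n) : Type v :=
  ∀ i : Fin n, Δ.Strategy i

open Classical in
/-- The number of agents that use the edge `e`. -/
noncomputable def load (Δ : Game G n) (σ : Δ.Profile) (e : G.E) : ℕ :=
  (Finset.univ.filter fun i => e ∈ (σ i).1).card

/-- No edge is used by more agents than its capacity. -/
def Feasible (Δ : Game G n) (σ : Δ.Profile) : Prop :=
  ∀ e, Δ.load σ e ≤ Δ.cap e

/-- The game is feasible: it has a feasible profile. -/
def IsFeasible (Δ : Game G n) : Prop :=
  ∃ σ : Δ.Profile, Δ.Feasible σ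

open Classical in
/-- The cost of agent `i`: fair shares of the costs of the edges of her path if the profile
is feasible, and `∞` otherwise. -/
noncomputable def agentCost (Δ : Game G n) (σ : Δ.Profile) (i : Fin n) : ℝ≥0∞ :=
  if Δ.Feasible σ then
    ((σ i).1.map fun e => (Δ.cost e : ℝ≥0∞) / (Δ.load σ e : ℝ≥0∞)).sum
  else ⊤

/-- Strong equilibrium: for every nonempty coalition `C` and every profile `τ` that arises
from `σ` by a joint deviation of `C`, some member of `C` does not strictly gain. -/
def IsStrongEquilibrium (Δ : Game G n) (σ : Δ.Profile) : Prop :=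
  ∀ C : Finset (Fin n), C.Nonempty → ∀ τ : Δ.Profile, (∀ i, i ∉ C → τ i = σ i) →
    ∃ j ∈ C, Δ.agentCost σ j ≤ Δ.agentCost τ j

end Game

/-- The network admits a strong equilibrium in single-source games: every feasible
single-source game on it, with any number of agents, has one. -/
def Network.AdmitsSEInSingleSourceGames (G : Network.{u, v}) : Prop :=
  ∀ (n : ℕ) (Δ : Game G n), Δ.IsSingleSource → Δ.IsFeasible →
    ∃ σ : Δ.Profile, Δ.IsStrongEquilibrium σ

end CCS

-- Call a node a hub if every walk from `s` to `t` visits it. Both sides of the equivalence are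
-- linked to a third condition, `Layered`: ranks increase along edges, no edge jumps over a node of
-- a separating set `H`, and outside `H` every node has just one incoming and one outgoing edge.
-- Such a network is a row of blocks, each a bundle of parallel chains.
--
-- Necessity. If a node that is no hub has two outgoing edges, the network contains an
-- `Obstruction`: a choice between two alternatives β, γ behind a common edge α, next to a bypass δ
-- (`obstruction_of_out`; two incoming edges are treated by reversal). Three agents with suitable
-- costs and capacities on these four edges then have no strong equilibrium (`exists_deviation`,
-- `not_admits`). Hence, if equilibria always exist, paths branch and merge at hubs only. This
-- excludes cycles, so the hubs layer the network, and cutting it at the hubs and peeling paths off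
-- each block shows that it is SPP (`Layered.isSPP`).
--
-- Sufficiency. SPP networks are layered (`IsSPP.exists_layered`). In a single-source game on a
-- layered network, an agent who has to cross a block chooses one of its chains, while the part of a
-- path beyond the last separating node before the sink is forced. So the load of an edge is a
-- constant plus the number of agents who choose its chain (`pathLoad_eq`), and each block is a
-- choice among capacitated resources that get cheaper with every user. Filling the cheapest
-- resource first, agents being served in a fixed order of priority, gives an assignment in which an
-- agent can gain only if someone of higher priority moves (`Greedy.exists_stable`). With the same
-- order in all blocks, farthest sinks first, the member of highest priority in any coalition does
-- not gain (`exists_stable_paths`).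

universe u'' v''

namespace CCS

/-! ### Walks, paths and reachability within a set of nodes -/

namespace Network

variable {G : Network.{u, v}}

theorem isWalk_append {p q : List G.E} {x y : G.V} :
    G.IsWalk x (p ++ q) y ↔ ∃ z, G.IsWalk x p z ∧ G.IsWalk z q y := by
  induction p generalizing x with
  | nil => simp [IsWalk]
  | cons e p ih =>
    simp only [List.cons_append, IsWalk, ih]
    constructor
    · rintro ⟨h, z, h1, h2⟩
      exact ⟨z, ⟨h, h1⟩, h2⟩
    · rintro ⟨z, ⟨h, h1⟩, h2⟩
      exact ⟨h, z, h1, h2⟩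

theorem start_mem_nodes (x : G.V) (p : List G.E) : x ∈ G.nodes x p := by
  simp [nodes]

theorem nodes_cons (x : G.V) (e : G.E) (p : List G.E) :
    G.nodes x (e :: p) = x :: G.nodes (G.tgt e) p := by
  simp [nodes]

theorem tgt_mem_nodes {x : G.V} {p : List G.E} {e : G.E} (he : e ∈ p) :
    G.tgt e ∈ G.nodes x p :=
  List.mem_cons_of_mem _ (List.mem_map_of_mem he)

theorem IsWalk.end_mem_nodes {x y : G.V} {p : List G.E} (h : G.IsWalk x p y) :
    y ∈ G.nodes x p := by
  induction p generalizing x with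
  | nil => cases h; exact start_mem_nodes _ _
  | cons e p ih =>
    rw [nodes_cons]
    exact List.mem_cons_of_mem _ (ih h.2)

theorem IsWalk.src_mem_nodes {x y : G.V} {p : List G.E} (h : G.IsWalk x p y) {e : G.E}
    (he : e ∈ p) : G.src e ∈ G.nodes x p := by
  induction p generalizing x with
  | nil => simp at he
  | cons f p ih =>
    rw [nodes_cons]
    rcases List.mem_cons.1 he with rfl | he
    · simp [h.1]
    · exact List.mem_cons_of_mem _ (ih h.2 he)

/-- A walk is split at any of its nodes. -/
theorem IsWalk.split {x y z : G.V} {p : List G.E} (h : G.IsWalk x p y) (hz : z ∈ G.nodes x p) :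
    ∃ p₁ p₂, p = p₁ ++ p₂ ∧ G.IsWalk x p₁ z ∧ G.IsWalk z p₂ y := by
  induction p generalizing x with
  | nil =>
    have : z = x := by simpa [nodes] using hz
    subst this
    exact ⟨[], [], rfl, rfl, h⟩
  | cons e p ih =>
    rw [nodes_cons] at hz
    rcases List.mem_cons.1 hz with rfl | hz
    · exact ⟨[], e :: p, rfl, rfl, h⟩
    · obtain ⟨p₁, p₂, rfl, h1, h2⟩ := ih h.2 hz
      exact ⟨e :: p₁, p₂, rfl, ⟨h.1, h1⟩, h2⟩

theorem nodes_append {x : G.V} {p q : List G.E} :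
    G.nodes x (p ++ q) = G.nodes x p ++ q.map G.tgt := by
  simp [nodes]

theorem nodes_append_cons {x : G.V} {p q : List G.E} {e : G.E} :
    G.nodes x (p ++ e :: q) = G.nodes x p ++ G.nodes (G.tgt e) q := by
  simp [nodes]

theorem IsWalk.nodes_suffix_subset {x z : G.V} {p q : List G.E} (h : G.IsWalk x p z) :
    G.nodes z q ⊆ G.nodes x (p ++ q) := by
  intro a ha
  rw [nodes_append]
  rcases List.mem_cons.1 ha with rfl | ha
  · exact List.mem_append_left _ h.end_mem_nodes
  · exact List.mem_append_right _ ha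

theorem nodes_prefix_subset {x : G.V} {p q : List G.E} :
    G.nodes x p ⊆ G.nodes x (p ++ q) := by
  intro a ha
  rw [nodes_append]
  exact List.mem_append_left _ ha

theorem IsPath.split {x y z : G.V} {p : List G.E} (h : G.IsPath x p y) (hz : z ∈ G.nodes x p) :
    ∃ p₁ p₂, p = p₁ ++ p₂ ∧ G.IsPath x p₁ z ∧ G.IsPath z p₂ y := by
  obtain ⟨p₁, p₂, rfl, h1, h2⟩ := h.1.split hz
  have hn := h.2
  rw [nodes_append] at hn
  refine ⟨p₁, p₂, rfl, ⟨h1, hn.of_append_left⟩, h2, ?_⟩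
  rw [nodes, List.nodup_cons]
  exact ⟨fun hz' => (List.disjoint_of_nodup_append hn) h1.end_mem_nodes hz', hn.of_append_right⟩

/-- A path through an edge is split into the parts before and after the edge. -/
theorem IsPath.split_edge {x y : G.V} {p : List G.E} (h : G.IsPath x p y) {e : G.E} (he : e ∈ p) :
    ∃ p₁ p₂, p = p₁ ++ e :: p₂ ∧ G.IsPath x p₁ (G.src e) ∧ G.IsPath (G.tgt e) p₂ y ∧
      (G.nodes x p₁).Disjoint (G.nodes (G.tgt e) p₂) := by
  obtain ⟨p₁, p₂, rfl⟩ := List.append_of_mem he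
  obtain ⟨z, h1, rfl, h2⟩ := isWalk_append.1 h.1
  have hn := h.2
  rw [nodes_append_cons] at hn
  exact ⟨p₁, p₂, rfl, ⟨h1, hn.of_append_left⟩, ⟨h2, hn.of_append_right⟩,
    List.disjoint_of_nodup_append hn⟩

theorem IsPath.append_cons {x y : G.V} {p q : List G.E} {e : G.E} (hp : G.IsPath x p (G.src e))
    (hq : G.IsPath (G.tgt e) q y) (hd : (G.nodes x p).Disjoint (G.nodes (G.tgt e) q)) :
    G.IsPath x (p ++ e :: q) y := by
  refine ⟨isWalk_append.2 ⟨_, hp.1, rfl, hq.1⟩, ?_⟩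
  rw [nodes_append_cons]
  exact hp.2.append hq.2 hd

theorem IsPath.edges_nodup {x y : G.V} {p : List G.E} (h : G.IsPath x p y) : p.Nodup :=
  List.Nodup.of_map _ (List.nodup_cons.1 h.2).2

theorem IsWalk.exists_succ {x y : G.V} {p : List G.E} (h : G.IsWalk x p y) {z : G.V}
    (hz : z ∈ G.nodes x p) (hy : z ≠ y) : ∃ e ∈ p, G.src e = z := by
  obtain ⟨p₁, p₂, rfl, h1, h2⟩ := h.split hz
  cases p₂ with
  | nil => exact absurd h2 hy
  | cons e p₂ => exact ⟨e, by simp, h2.1⟩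

theorem IsWalk.exists_pred {x : G.V} {p : List G.E} {z : G.V}
    (hz : z ∈ G.nodes x p) (hx : z ≠ x) : ∃ e ∈ p, G.tgt e = z := by
  rcases List.mem_cons.1 hz with h | h
  · exact absurd h hx
  · simpa using h

theorem IsPath.eq_of_src {x y : G.V} {p : List G.E} (h : G.IsPath x p y) {e f : G.E} (he : e ∈ p)
    (hf : f ∈ p) (hs : G.src e = G.src f) : e = f := by
  obtain ⟨p₁, p₂, rfl, h1, h2, hd⟩ := h.split_edge he
  rcases List.mem_append.1 hf with hf | hf
  · exfalso
    obtain ⟨q₁, q₂, rfl, h3, h4, hd'⟩ := h1.split_edge hf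
    exact hd' h3.1.end_mem_nodes (hs ▸ h4.1.end_mem_nodes)
  · rcases List.mem_cons.1 hf with rfl | hf
    · rfl
    · exact (hd h1.1.end_mem_nodes (hs ▸ h2.1.src_mem_nodes hf)).elim

/-- `G.ReachIn W a b`: there is a walk from `a` to `b` all of whose nodes lie in `W`. -/
def ReachIn (G : Network.{u, v}) (W : Set G.V) (a b : G.V) : Prop :=
  ∃ p, G.IsWalk a p b ∧ ∀ z ∈ G.nodes a p, z ∈ W

theorem ReachIn.mono {W W' : Set G.V} {a b : G.V} (h : G.ReachIn W a b) (hW : W ⊆ W') :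
    G.ReachIn W' a b :=
  let ⟨p, h1, h2⟩ := h
  ⟨p, h1, fun z hz => hW (h2 z hz)⟩

theorem ReachIn.trans {W : Set G.V} {a b c : G.V} (h : G.ReachIn W a b) (h' : G.ReachIn W b c) :
    G.ReachIn W a c := by
  obtain ⟨p, h1, h2⟩ := h
  obtain ⟨q, h3, h4⟩ := h'
  refine ⟨p ++ q, isWalk_append.2 ⟨b, h1, h3⟩, fun z hz => ?_⟩
  rw [nodes_append] at hz
  rcases List.mem_append.1 hz with hz | hz
  · exact h2 z hz
  · exact h4 z (List.mem_cons_of_mem _ hz)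

theorem ReachIn.left_mem {W : Set G.V} {a b : G.V} (h : G.ReachIn W a b) : a ∈ W :=
  let ⟨_, _, h2⟩ := h
  h2 a (start_mem_nodes _ _)

theorem ReachIn.right_mem {W : Set G.V} {a b : G.V} (h : G.ReachIn W a b) : b ∈ W :=
  let ⟨_, h1, h2⟩ := h
  h2 b h1.end_mem_nodes

theorem ReachIn.refl {W : Set G.V} {a : G.V} (h : a ∈ W) : G.ReachIn W a a :=
  ⟨[], rfl, by simpa [nodes] using h⟩

theorem ReachIn.head {W : Set G.V} {e : G.E} {b : G.V} (h : G.src e ∈ W)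
    (h' : G.ReachIn W (G.tgt e) b) : G.ReachIn W (G.src e) b := by
  obtain ⟨p, h1, h2⟩ := h'
  refine ⟨e :: p, ⟨rfl, h1⟩, ?_⟩
  rw [nodes_cons]
  simpa [h] using h2

theorem IsWalk.reachIn {a b : G.V} {p : List G.E} (h : G.IsWalk a p b) {W : Set G.V}
    (hW : ∀ z ∈ G.nodes a p, z ∈ W) : G.ReachIn W a b :=
  ⟨p, h, hW⟩

/-- A walk contains a path with the same ends. -/
theorem ReachIn.exists_path {W : Set G.V} {a b : G.V} (h : G.ReachIn W a b) :
    ∃ p, G.IsPath a p b ∧ ∀ z ∈ G.nodes a p, z ∈ W := by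
  obtain ⟨p, h1, h2⟩ := h
  induction p generalizing a with
  | nil => exact ⟨[], ⟨h1, by simp [nodes]⟩, h2⟩
  | cons e p ih =>
    rw [nodes_cons] at h2
    obtain ⟨q, h3, h4⟩ := ih h1.2 fun z hz => h2 z (List.mem_cons_of_mem _ hz)
    by_cases ha : a ∈ G.nodes (G.tgt e) q
    · obtain ⟨q₁, q₂, rfl, h5, h6⟩ := h3.split ha
      exact ⟨q₂, h6, fun z hz => h4 z (h5.1.nodes_suffix_subset hz)⟩
    · refine ⟨e :: q, ⟨⟨h1.1, h3.1⟩, ?_⟩, ?_⟩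
      · rw [nodes_cons]
        exact List.nodup_cons.2 ⟨ha, h3.2⟩
      · rw [nodes_cons]
        simpa using ⟨h2 a (by simp), h4⟩

/-- A walk either avoids `S` or leaves `S` for the last time along some edge. -/
theorem ReachIn.last_exit {W : Set G.V} {a b : G.V} (h : G.ReachIn W a b) (S : Set G.V)
    (hb : b ∉ S) : G.ReachIn (W ∩ Sᶜ) a b ∨
      ∃ e, G.src e ∈ S ∧ G.src e ∈ W ∧ G.ReachIn (W ∩ Sᶜ) (G.tgt e) b := by
  obtain ⟨p, h1, h2⟩ := h
  induction p generalizing a with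
  | nil =>
    cases h1
    exact .inl (.refl ⟨h2 _ (start_mem_nodes _ _), hb⟩)
  | cons e p ih =>
    rw [nodes_cons] at h2
    obtain ⟨rfl, h1⟩ := h1
    rcases ih h1 fun z hz => h2 z (List.mem_cons_of_mem _ hz) with h | h
    · by_cases ha : G.src e ∈ S
      · exact .inr ⟨e, ha, h2 _ (by simp), h⟩
      · exact .inl (.head ⟨h2 _ (by simp), ha⟩ h)
    · exact .inr h

end Network

/-! ### Obstructions from branching at a node that is no hub -/

namespace Network

variable {G : Network.{u, v}}

/-- A set `F` of edges in which every path from `x` to `y` meets the edges `α, β, γ, δ` in exactly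
`{α, β}`, `{α, γ}` or `{δ}`, all three of which occur. -/
structure Obstruction (G : Network.{u, v}) where
  x : G.V
  y : G.V
  α : G.E
  β : G.E
  γ : G.E
  δ : G.E
  F : Set G.E
  trace : ∀ p, G.IsPath x p y → (∀ e ∈ p, e ∈ F) →
    (α ∈ p ∧ β ∈ p ∧ γ ∉ p ∧ δ ∉ p) ∨ (α ∈ p ∧ β ∉ p ∧ γ ∈ p ∧ δ ∉ p) ∨
      (α ∉ p ∧ β ∉ p ∧ γ ∉ p ∧ δ ∈ p)
  exists_β : ∃ p, G.IsPath x p y ∧ (∀ e ∈ p, e ∈ F) ∧ α ∈ p ∧ β ∈ p ∧ γ ∉ p ∧ δ ∉ p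
  exists_γ : ∃ p, G.IsPath x p y ∧ (∀ e ∈ p, e ∈ F) ∧ α ∈ p ∧ β ∉ p ∧ γ ∈ p ∧ δ ∉ p
  exists_δ : ∃ p, G.IsPath x p y ∧ (∀ e ∈ p, e ∈ F) ∧ α ∉ p ∧ β ∉ p ∧ γ ∉ p ∧ δ ∈ p

/-- The network with all edges reversed. -/
abbrev rev (G : Network.{u, v}) : Network.{u, v} where
  V := G.V
  E := G.E
  src := G.tgt
  tgt := G.src
  s := G.t
  t := G.s

theorem IsWalk.reverse {x y : G.V} {p : List G.E} (h : G.IsWalk x p y) :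
    G.rev.IsWalk y p.reverse x := by
  induction p generalizing x with
  | nil => exact Eq.symm h
  | cons e p ih =>
    rw [List.reverse_cons]
    exact isWalk_append.2 ⟨_, ih h.2, rfl, h.1⟩

theorem IsWalk.nodes_reverse {x y : G.V} {p : List G.E} (h : G.IsWalk x p y) :
    G.rev.nodes y p.reverse = (G.nodes x p).reverse := by
  induction p generalizing x with
  | nil => cases h; rfl
  | cons e p ih =>
    rw [List.reverse_cons, nodes_append, ih h.2, nodes_cons, List.reverse_cons]
    simp [rev, h.1]

theorem IsPath.reverse {x y : G.V} {p : List G.E} (h : G.IsPath x p y) :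
    G.rev.IsPath y p.reverse x :=
  ⟨h.1.reverse, by rw [h.1.nodes_reverse]; exact List.nodup_reverse.2 h.2⟩

theorem IsTwoTerminal.rev (h : G.IsTwoTerminal) : G.rev.IsTwoTerminal where
  s_ne_t := h.s_ne_t.symm
  node_mem x := by
    obtain ⟨p, h1, h2⟩ := h.node_mem x
    refine ⟨p.reverse, h1.reverse, ?_⟩
    rw [show G.rev.s = G.t from rfl, h1.1.nodes_reverse]
    exact List.mem_reverse.2 h2
  edge_mem e := by
    obtain ⟨p, h1, h2⟩ := h.edge_mem e
    exact ⟨p.reverse, h1.reverse, List.mem_reverse.2 h2⟩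

theorem ReachIn.reverse {W : Set G.V} {a b : G.V} (h : G.ReachIn W a b) :
    G.rev.ReachIn W b a := by
  obtain ⟨p, h1, h2⟩ := h
  refine ⟨p.reverse, h1.reverse, fun z hz => h2 z ?_⟩
  rw [h1.nodes_reverse] at hz
  exact List.mem_reverse.1 hz

/-- Obstructions are invariant under reversal. -/
def Obstruction.rev (O : G.rev.Obstruction) : G.Obstruction where
  x := O.y
  y := O.x
  α := O.α
  β := O.β
  γ := O.γ
  δ := O.δ
  F := O.F
  trace p hp hF := by
    simpa using O.trace p.reverse hp.reverse fun e he => hF e (List.mem_reverse.1 he)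
  exists_β := by
    obtain ⟨p, h1, h2, h3⟩ := O.exists_β
    exact ⟨p.reverse, h1.reverse, fun e he => h2 e (List.mem_reverse.1 he), by simpa using h3⟩
  exists_γ := by
    obtain ⟨p, h1, h2, h3⟩ := O.exists_γ
    exact ⟨p.reverse, h1.reverse, fun e he => h2 e (List.mem_reverse.1 he), by simpa using h3⟩
  exists_δ := by
    obtain ⟨p, h1, h2, h3⟩ := O.exists_δ
    exact ⟨p.reverse, h1.reverse, fun e he => h2 e (List.mem_reverse.1 he), by simpa using h3⟩

/-- The set of nodes of a walk. -/
def nodeSet (G : Network.{u, v}) (x : G.V) (p : List G.E) : Set G.V :=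
  {z | z ∈ G.nodes x p}

/-- A path from which one edge leaves at the first node and two edges leave at the last node,
all of them towards the sink and without returning to the path, yields an obstruction. -/
theorem obstruction_of_exits {x : G.V} {π : List G.E} {β γ δ : G.E}
    (hπ : G.IsPath x π (G.src β)) (hx : x ≠ G.src β) (hβγ : β ≠ γ) (hγs : G.src γ = G.src β)
    (hδs : G.src δ = x) (hβ : G.ReachIn (G.nodeSet x π)ᶜ (G.tgt β) G.t)
    (hγ : G.ReachIn (G.nodeSet x π)ᶜ (G.tgt γ) G.t)
    (hδ : G.ReachIn (G.nodeSet x π)ᶜ (G.tgt δ) G.t) : Nonempty G.Obstruction := by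
  set S := G.nodeSet x π with hS
  set v := G.src β with hv
  have hxS : x ∈ S := start_mem_nodes _ _
  have hvS : v ∈ S := hπ.1.end_mem_nodes
  obtain ⟨α, hαπ, hαt⟩ := IsWalk.exists_pred (G := G) (show v ∈ G.nodes x π from hvS) hx.symm
  have hπsrc : ∀ e ∈ π, G.src e ∈ S ∧ G.src e ≠ v := by
    intro e he
    refine ⟨hπ.1.src_mem_nodes he, fun h => ?_⟩
    obtain ⟨p₁, p₂, rfl, h1, h2, hd⟩ := hπ.split_edge he
    exact hd (h ▸ h1.1.end_mem_nodes) h2.1.end_mem_nodes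
  have hπα : ∀ e ∈ π, G.tgt e = v → e = α := by
    intro e he het
    refine List.inj_on_of_nodup_map (List.nodup_cons.1 hπ.2).2 he hαπ (het.trans hαt.symm)
  have hβπ : β ∉ π := fun h => (hπsrc _ h).2 rfl
  have hγπ : γ ∉ π := fun h => (hπsrc _ h).2 hγs
  have hδπ : δ ∉ π := fun h => hδ.left_mem (tgt_mem_nodes h)
  have hδβ : δ ≠ β := fun h => hx (by rw [← hδs, h])
  have hδγ : δ ≠ γ := fun h => hx (by rw [← hδs, h, hγs])
  have hαS := hπsrc α hαπ
  -- Within `F` a walk from `x` to the sink has to follow π until it leaves by δ at `x` or by β or γ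
  -- at `v`, and it never returns to `S`. As α is the last edge of π, it is used exactly by the
  -- walks that get to `v`.
  let F : Set G.E := {e | e ∈ π ∨ e = β ∨ e = γ ∨ e = δ ∨ (G.src e ∉ S ∧ G.tgt e ∉ S)}
  have hout : ∀ p z, z ∉ S → G.IsWalk z p G.t → (∀ e ∈ p, e ∈ F) → ∀ e ∈ p, G.src e ∉ S := by
    intro p
    induction p with
    | nil => simp
    | cons f p ih =>
      rintro z hz ⟨rfl, hw⟩ hF e he
      have hf : G.tgt f ∉ S := by
        rcases hF f (by simp) with h | rfl | rfl | rfl | h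
        · exact absurd (hπsrc f h).1 hz
        · exact absurd hvS hz
        · exact absurd (hγs ▸ hvS) hz
        · exact absurd (hδs ▸ hxS) hz
        · exact h.2
      rcases List.mem_cons.1 he with rfl | he
      · exact hz
      · exact ih _ hf hw (fun e he => hF e (List.mem_cons_of_mem _ he)) e he
  have hout' : ∀ p z, z ∉ S → G.IsWalk z p G.t → (∀ e ∈ p, e ∈ F) →
      α ∉ p ∧ β ∉ p ∧ γ ∉ p ∧ δ ∉ p := fun p z hz hw hF =>
    ⟨fun h => hout p z hz hw hF _ h hαS.1, fun h => hout p z hz hw hF _ h hvS,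
      fun h => hout p z hz hw hF _ h (hγs ▸ hvS), fun h => hout p z hz hw hF _ h (hδs ▸ hxS)⟩
  have hαβ : α ≠ β := fun h => hβπ (h ▸ hαπ)
  have hαγ : α ≠ γ := fun h => hγπ (h ▸ hαπ)
  have hαδ : α ≠ δ := fun h => hδπ (h ▸ hαπ)
  have htS : G.t ∉ S := hβ.right_mem
  have hmid : ∀ p, G.IsWalk v p G.t → (∀ e ∈ p, e ∈ F) →
      (α ∉ p ∧ β ∈ p ∧ γ ∉ p ∧ δ ∉ p) ∨ (α ∉ p ∧ β ∉ p ∧ γ ∈ p ∧ δ ∉ p) := by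
    intro p hw hF
    cases p with
    | nil => exact absurd (show v = G.t from hw) fun h => htS (h ▸ hvS)
    | cons f p =>
      obtain ⟨hf, hw⟩ := hw
      have hF' : ∀ e ∈ p, e ∈ F := fun e he => hF e (List.mem_cons_of_mem _ he)
      rcases hF f (by simp) with h | rfl | rfl | rfl | h
      · exact absurd hf (hπsrc f h).2
      · have := hout' p _ hβ.left_mem hw hF'
        exact .inl (by simp [this, hαβ, hβγ.symm, hδβ])
      · have := hout' p _ hγ.left_mem hw hF'
        exact .inr (by simp [this, hαγ, hβγ, hδγ])
      · exact absurd (hδs.symm.trans hf) hx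
      · exact absurd (hf ▸ hvS) h.1
  have htrace : ∀ p z, z ∈ S → z ≠ v → G.IsWalk z p G.t → (∀ e ∈ p, e ∈ F) →
      (α ∈ p ∧ β ∈ p ∧ γ ∉ p ∧ δ ∉ p) ∨ (α ∈ p ∧ β ∉ p ∧ γ ∈ p ∧ δ ∉ p) ∨
        (α ∉ p ∧ β ∉ p ∧ γ ∉ p ∧ δ ∈ p) := by
    intro p
    induction p with
    | nil => rintro z hz - rfl; exact absurd hz htS
    | cons f p ih =>
      rintro z hz hzv ⟨rfl, hw⟩ hF
      have hF' : ∀ e ∈ p, e ∈ F := fun e he => hF e (List.mem_cons_of_mem _ he)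
      rcases hF f (by simp) with h | rfl | rfl | rfl | h
      · have hfβ : β ≠ f := fun h' => hβπ (h' ▸ h)
        have hfγ : γ ≠ f := fun h' => hγπ (h' ▸ h)
        have hfδ : δ ≠ f := fun h' => hδπ (h' ▸ h)
        by_cases hfv : G.tgt f = v
        · obtain rfl := hπα f h hfv
          rw [hfv] at hw
          rcases hmid p hw hF' with h | h
          · exact .inl (by simp [h, hfβ, hfγ, hfδ])
          · exact .inr (.inl (by simp [h, hfβ, hfγ, hfδ]))
        · have hfα : α ≠ f := fun h' => hfv (h' ▸ hαt)
          simpa [hfα, hfβ, hfγ, hfδ] using ih _ (tgt_mem_nodes h) hfv hw hF'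
      · exact absurd rfl hzv
      · exact absurd hγs hzv
      · have := hout' p _ hδ.left_mem hw hF'
        exact .inr (.inr (by simp [this, hαδ, hδβ.symm, hδγ.symm]))
      · exact absurd hz h.1
  have hsuff : ∀ {z : G.V} {q : List G.E}, G.IsPath z q G.t →
      (∀ w ∈ G.nodes z q, w ∈ Sᶜ) → ∀ e ∈ q, e ∈ F := fun {z q} hq hqS e he =>
    .inr (.inr (.inr (.inr ⟨hqS _ (hq.1.src_mem_nodes he), hqS _ (tgt_mem_nodes he)⟩)))
  have hlong : ∀ ε : G.E, (ε = β ∨ ε = γ) → G.ReachIn Sᶜ (G.tgt ε) G.t →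
      ∃ p, G.IsPath x p G.t ∧ (∀ e ∈ p, e ∈ F) ∧ α ∈ p ∧ ε ∈ p := by
    intro ε hε hr
    obtain ⟨q, hq, hqS⟩ := hr.exists_path
    have hεs : G.src ε = v := by rcases hε with rfl | rfl <;> [rfl; exact hγs]
    refine ⟨π ++ ε :: q, IsPath.append_cons (hεs ▸ hπ) hq fun a ha ha' => hqS a ha' ha, ?_,
      by simp [hαπ], by simp⟩
    intro e he
    rcases List.mem_append.1 he with he | he
    · exact .inl he
    · rcases List.mem_cons.1 he with rfl | he
      · rcases hε with rfl | rfl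
        · exact .inr (.inl rfl)
        · exact .inr (.inr (.inl rfl))
      · exact hsuff hq hqS e he
  refine ⟨⟨x, G.t, α, β, γ, δ, F, fun p hp hF => htrace p x hxS hx hp.1 hF, ?_, ?_, ?_⟩⟩
  · obtain ⟨p, h1, h2, h3, h4⟩ := hlong β (.inl rfl) hβ
    exact ⟨p, h1, h2, by have := htrace p x hxS hx h1.1 h2; tauto⟩
  · obtain ⟨p, h1, h2, h3, h4⟩ := hlong γ (.inr rfl) hγ
    exact ⟨p, h1, h2, by have := htrace p x hxS hx h1.1 h2; tauto⟩
  · obtain ⟨q, hq, hqS⟩ := hδ.exists_path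
    have hp : G.IsPath x (δ :: q) G.t := by
      refine ⟨⟨hδs, hq.1⟩, ?_⟩
      rw [nodes_cons, List.nodup_cons]
      exact ⟨fun h => hqS _ h hxS, hq.2⟩
    have hpF : ∀ e ∈ δ :: q, e ∈ F := by
      intro e he
      rcases List.mem_cons.1 he with rfl | he
      · exact .inr (.inr (.inr (.inl rfl)))
      · exact hsuff hq hqS e he
    refine ⟨δ :: q, hp, hpF, ?_⟩
    have h1 := htrace _ x hxS hx hp.1 hpF
    have h2 : δ ∈ δ :: q := by simp
    tauto

/-- `v` is a hub: every walk from the source to the sink visits `v`. -/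
def IsHub (G : Network.{u, v}) (v : G.V) : Prop :=
  ¬ G.ReachIn {v}ᶜ G.s G.t

/-- Some walk from source to sink avoids the branching node, as this is no hub. Its last exit from
the path supplies δ, and the rest of the path, from that exit to the branching node, plays the role
of π. -/
theorem obstruction_of_two_exits {π : List G.E} {β γ : G.E}
    (hπ : G.IsPath G.s π (G.src β)) (hβγ : β ≠ γ) (hγs : G.src γ = G.src β)
    (hβ : G.ReachIn (G.nodeSet G.s π)ᶜ (G.tgt β) G.t)
    (hγ : G.ReachIn (G.nodeSet G.s π)ᶜ (G.tgt γ) G.t) (hv : ¬ G.IsHub (G.src β)) :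
    Nonempty G.Obstruction := by
  rw [IsHub, not_not] at hv
  rcases hv.last_exit (G.nodeSet G.s π) hβ.right_mem with h | ⟨δ, h1, h2, h3⟩
  · exact absurd (start_mem_nodes _ _) h.left_mem.2
  · obtain ⟨π₁, π₂, rfl, h4, h5⟩ := hπ.split h1
    have hsub : (G.nodeSet G.s (π₁ ++ π₂))ᶜ ⊆ (G.nodeSet (G.src δ) π₂)ᶜ :=
      Set.compl_subset_compl.2 h4.1.nodes_suffix_subset
    exact obstruction_of_exits h5 h2 hβγ hγs rfl (hβ.mono hsub) (hγ.mono hsub)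
      (h3.mono (Set.inter_subset_right.trans hsub))

/-- Take a path through β and a path through γ. If γ can reach the sink without returning to the
part before β, the branching node itself will do. Otherwise the walk behind γ returns to that part
and leaves it for good along some δ; then the tail of δ is the branching node to use, with δ and the
next edge of the path as its two exits. -/
theorem obstruction_of_out (hG : G.IsTwoTerminal) {β γ : G.E} (hβγ : β ≠ γ)
    (hs : G.src γ = G.src β) (hv : ¬ G.IsHub (G.src β)) : Nonempty G.Obstruction := by
  obtain ⟨p, hp, hβp⟩ := hG.edge_mem β
  obtain ⟨p₁, p₂, rfl, h1, h2, hd⟩ := hp.split_edge hβp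
  obtain ⟨q, hq, hγq⟩ := hG.edge_mem γ
  obtain ⟨q₁, q₂, rfl, h3, h4, hd'⟩ := hq.split_edge hγq
  have hβ : G.ReachIn (G.nodeSet G.s p₁)ᶜ (G.tgt β) G.t :=
    h2.1.reachIn fun z hz hz' => hd hz' hz
  have hγ : G.ReachIn (G.nodeSet G.s q₁)ᶜ (G.tgt γ) G.t :=
    h4.1.reachIn fun z hz hz' => hd' hz' hz
  rcases hγ.last_exit (G.nodeSet G.s p₁) hβ.right_mem with h | ⟨δ, h5, h6, h7⟩
  · exact obstruction_of_two_exits h1 hβγ hs hβ (h.mono Set.inter_subset_right) hv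
  have hgv : G.src δ ≠ G.src β := fun h => h6 (by
    rw [h, ← hs]; exact h3.1.end_mem_nodes)
  obtain ⟨a, b, rfl, h8, h9⟩ := h1.split h5
  cases b with
  | nil => exact absurd h9.1 hgv
  | cons e b =>
    obtain ⟨he, hb⟩ := h9.1
    have hn := hp.2
    rw [List.append_assoc, List.cons_append, nodes_append_cons] at hn
    have hdisj := List.disjoint_of_nodup_append hn
    have h10 : G.ReachIn (G.nodeSet G.s a)ᶜ (G.tgt e) G.t :=
      IsWalk.reachIn (p := b ++ β :: p₂) (isWalk_append.2 ⟨_, hb, rfl, h2.1⟩)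
        fun z hz hz' => hdisj hz' hz
    have hsub : (G.nodeSet G.s (a ++ e :: b))ᶜ ⊆ (G.nodeSet G.s a)ᶜ :=
      Set.compl_subset_compl.2 nodes_prefix_subset
    have hne : δ ≠ e := by
      rintro rfl
      exact h7.left_mem.2 (tgt_mem_nodes (by simp))
    refine obstruction_of_two_exits (β := δ) h8 hne he (h7.mono (Set.inter_subset_right.trans hsub))
      h10 ?_
    -- The tail of δ is no hub: the part before γ leads to the tail of β without visiting it, and
    -- the path through β goes on to the sink without returning.
    rw [IsHub, not_not]
    refine ReachIn.trans (b := G.src β) ?_ ?_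
    · rw [← hs]
      exact h3.1.reachIn fun z hz hz' => h6 (by rw [← show z = G.src δ from hz']; exact hz)
    · exact .head (fun h => hgv (Eq.symm h)) (hβ.mono fun z hz hz' => hz (by
        rw [show z = G.src δ from hz']; exact h5))

/-- Reversal keeps hubs and swaps incoming with outgoing edges. It also swaps the ends of an
obstruction, whence both ends are left arbitrary in `Obstruction`. -/
theorem obstruction_of_in (hG : G.IsTwoTerminal) {β γ : G.E} (hβγ : β ≠ γ)
    (hs : G.tgt γ = G.tgt β) (hv : ¬ G.IsHub (G.tgt β)) : Nonempty G.Obstruction := by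
  obtain ⟨O⟩ := obstruction_of_out (G := G.rev) hG.rev hβγ hs (by
    rw [IsHub, not_not] at hv ⊢
    exact hv.reverse)
  exact ⟨O.rev⟩

end Network

/-! ### A three-agent game on an obstruction -/

theorem _root_.List.Nodup.sum_map_eq_ite {ι M : Type*} [DecidableEq ι] [AddCommMonoid M]
    {p : List ι} (hp : p.Nodup) (s : Finset ι) (f : ι → M) (hf : ∀ e ∈ p, e ∉ s → f e = 0) :
    (p.map f).sum = ∑ e ∈ s, if e ∈ p then f e else 0 := by
  rw [← List.sum_toFinset f hp, ← Finset.sum_filter]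
  symm
  refine Finset.sum_subset_zero_on_sdiff (fun e he => by simpa using (Finset.mem_filter.1 he).2)
    (fun e he => ?_) fun _ _ => rfl
  rw [Finset.mem_sdiff, List.mem_toFinset, Finset.mem_filter, not_and'] at he
  exact hf e he.1 (he.2 he.1)

theorem _root_.ENNReal.natCast_div_natCast {m k : ℕ} (hk : k ≠ 0) (h : k ∣ m) :
    (m : ℝ≥0∞) / k = ((m / k : ℕ) : ℝ≥0∞) := by
  obtain ⟨c, rfl⟩ := h
  rw [Nat.mul_div_cancel_left _ (Nat.pos_of_ne_zero hk), Nat.cast_mul, mul_comm]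
  exact ENNReal.mul_div_cancel_right (by exact_mod_cast hk) (ENNReal.natCast_ne_top k)

namespace ThreePlayer

/-- The number of agents of type `a`, in a profile of types of three agents. -/
def count (t : Fin 3 → Fin 3) (a : Fin 3) : ℕ :=
  (Finset.univ.filter fun i => t i = a).card

/-- Capacities hold for a profile of types: at most two agents have types `0` or `1`, at most one
has type `0`, and at most two have type `2`. -/
def Ok (t : Fin 3 → Fin 3) : Prop :=
  count t 0 + count t 1 ≤ 2 ∧ count t 0 ≤ 1 ∧ count t 2 ≤ 2

instance (t : Fin 3 → Fin 3) : Decidable (Ok t) := by unfold Ok; infer_instance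

/-- The cost of agent `i` in a profile of types. -/
def cost (t : Fin 3 → Fin 3) (i : Fin 3) : ℕ :=
  if t i = 0 then 48 / (count t 0 + count t 1)
  else if t i = 1 then 48 / (count t 0 + count t 1) + 12 / count t 1
  else 60 / count t 2

-- Up to the order of the agents, the capacities leave the types 012, 112, 022, 122, with costs 24,
-- 36, 60; 30, 30, 60; 48, 30, 30; 60, 30, 30. In 012 the agent of type 1 gains by moving to 2. In
-- 112 and 122 an agent of type 1 gains by moving to 0. In 022 a coalition of two is needed: the
-- agent of type 0 moves to 1 and pays 36 instead of 48, while an agent of type 2 takes over type 0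
-- and pays 24 instead of 30.
set_option maxRecDepth 100000 in
theorem exists_deviation : ∀ t, Ok t →
    ∃ t', Ok t' ∧ (∃ j, t' j ≠ t j) ∧ ∀ j, t' j ≠ t j → cost t' j < cost t j := by
  decide +kernel

theorem count_add (t : Fin 3 → Fin 3) : count t 0 + count t 1 + count t 2 = 3 := by
  revert t
  decide +kernel

theorem count_pos (t : Fin 3 → Fin 3) (i : Fin 3) : 0 < count t (t i) :=
  Finset.card_pos.2 ⟨i, by simp⟩

end ThreePlayer

namespace Network.Obstruction

open Classical ThreePlayer

variable {G : Network.{u, v}} (O : G.Obstruction)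

theorem pairwise_ne : O.α ≠ O.β ∧ O.α ≠ O.γ ∧ O.α ≠ O.δ ∧ O.β ≠ O.γ ∧ O.β ≠ O.δ ∧ O.γ ≠ O.δ := by
  obtain ⟨p, -, -, h1, h2, h3, h4⟩ := O.exists_β
  obtain ⟨q, -, -, h5, h6, h7, h8⟩ := O.exists_γ
  refine ⟨?_, ?_, ?_, ?_, ?_, ?_⟩ <;> intro h <;> simp_all

/-- A three-agent game without strong equilibrium. -/
noncomputable def game : Game G 3 where
  source _ := O.x
  sink _ := O.y
  cost e := if e = O.α then 48 else if e = O.γ then 12 else if e = O.δ then 60 else 0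
  -- Capacity 3 never binds for three agents, and capacity 0 confines feasible profiles to `F`,
  -- where `trace` leaves only the three types.
  cap e := if e = O.α then 2 else if e = O.β then 1 else if e = O.δ then 2 else
    if e ∈ O.F then 3 else 0

theorem cap_α : O.game.cap O.α = 2 := if_pos rfl

theorem cap_β : O.game.cap O.β = 1 := by
  simp [game, O.pairwise_ne.1.symm]

theorem cap_δ : O.game.cap O.δ = 2 := by
  simp [game, O.pairwise_ne.2.2.2.2.1.symm]

/-- The type of a path. -/
noncomputable def type (p : List G.E) : Fin 3 :=
  if O.δ ∈ p then 2 else if O.γ ∈ p then 1 else 0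

/-- The trace of a path that is determined by its type. -/
structure Fits (p : List G.E) : Prop where
  mem_F : ∀ e ∈ p, e ∈ O.F
  mem_α : O.α ∈ p ↔ O.type p = 0 ∨ O.type p = 1
  mem_β : O.β ∈ p ↔ O.type p = 0
  mem_γ : O.γ ∈ p ↔ O.type p = 1
  mem_δ : O.δ ∈ p ↔ O.type p = 2

theorem fits_of_isPath {p : List G.E} (hp : G.IsPath O.x p O.y) (hF : ∀ e ∈ p, e ∈ O.F) :
    O.Fits p := by
  rcases O.trace p hp hF with h | h | h <;> exact ⟨hF, by simp [type, h], by simp [type, h], by simp [type, h], by simp [type, h]⟩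

theorem exists_type (a : Fin 3) : ∃ p, G.IsPath O.x p O.y ∧ O.Fits p ∧ O.type p = a := by
  match a with
  | 0 =>
    obtain ⟨p, h1, h2, h3⟩ := O.exists_β
    exact ⟨p, h1, O.fits_of_isPath h1 h2, by simp [type, h3]⟩
  | 1 =>
    obtain ⟨p, h1, h2, h3⟩ := O.exists_γ
    exact ⟨p, h1, O.fits_of_isPath h1 h2, by simp [type, h3]⟩
  | 2 =>
    obtain ⟨p, h1, h2, h3⟩ := O.exists_δ
    exact ⟨p, h1, O.fits_of_isPath h1 h2, by simp [type, h3]⟩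

/-- The types of the agents in a profile. -/
noncomputable def types (σ : O.game.Profile) : Fin 3 → Fin 3 := fun i => O.type (σ i).1

section

variable {O} {σ : O.game.Profile} (hσ : ∀ i, O.Fits (σ i).1)
include hσ

theorem load_β : O.game.load σ O.β = count (O.types σ) 0 := by
  simp only [Game.load, count, types, (hσ _).mem_β]
  congr

theorem load_γ : O.game.load σ O.γ = count (O.types σ) 1 := by
  simp only [Game.load, count, types, (hσ _).mem_γ]
  congr

theorem load_δ : O.game.load σ O.δ = count (O.types σ) 2 := by
  simp only [Game.load, count, types, (hσ _).mem_δ]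
  congr

theorem load_α : O.game.load σ O.α = count (O.types σ) 0 + count (O.types σ) 1 := by
  have h : ∀ i ∈ (Finset.univ : Finset (Fin 3)),
      O.α ∈ (σ i).1 ↔ O.types σ i = 0 ∨ O.types σ i = 1 := fun i _ => (hσ i).mem_α
  rw [Game.load, Finset.filter_congr h, Finset.filter_or, Finset.card_union_of_disjoint]
  · simp only [count]
  · exact Finset.disjoint_filter.2 fun i _ h h' => by simp [h] at h'

theorem feasible_iff : O.game.Feasible σ ↔ Ok (O.types σ) := by
  obtain ⟨n1, n2, n3, n4, n5, n6⟩ := O.pairwise_ne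
  constructor
  · intro h
    refine ⟨?_, ?_, ?_⟩
    · simpa only [load_α hσ, cap_α] using h O.α
    · simpa only [load_β hσ, cap_β] using h O.β
    · simpa only [load_δ hσ, cap_δ] using h O.δ
  · rintro ⟨h1, h2, h3⟩ e
    simp only [game]
    split_ifs with h4 h5 h6 h7
    · exact h4 ▸ (load_α hσ).trans_le h1
    · exact h5 ▸ (load_β hσ).trans_le h2
    · exact h6 ▸ (load_δ hσ).trans_le h3
    · exact (Finset.card_filter_le _ _).trans (by simp)
    · refine (Finset.card_eq_zero.2 (Finset.filter_eq_empty_iff.2 ?_)).le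
      exact fun i _ hi => h7 ((hσ i).mem_F e hi)

/-- All edge costs are multiples of 12 and loads are at most 3, so the divisions of natural numbers
in `ThreePlayer.cost` are exact. -/
theorem agentCost_eq (h : O.game.Feasible σ) (i : Fin 3) :
    O.game.agentCost σ i = (ThreePlayer.cost (O.types σ) i : ℕ) := by
  obtain ⟨n1, n2, n3, n4, n5, n6⟩ := O.pairwise_ne
  have hp := count_pos (O.types σ) i
  have hadd := count_add (O.types σ)
  have key : ∀ {m k : ℕ}, k ≠ 0 → k ≤ 3 → 12 ∣ m → (m : ℝ≥0∞) / k = ((m / k : ℕ) : ℝ≥0∞) := by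
    intro m k h1 h2 h3
    refine ENNReal.natCast_div_natCast h1 (dvd_trans ?_ h3)
    interval_cases k <;> omega
  rw [Game.agentCost, if_pos h, List.Nodup.sum_map_eq_ite (σ i).2.edges_nodup {O.α, O.γ, O.δ}]
  · rw [Finset.sum_insert (by simp [n2, n3]), Finset.sum_insert (by simp [n6]),
      Finset.sum_singleton]
    simp only [(hσ i).mem_α, (hσ i).mem_γ, (hσ i).mem_δ, load_α hσ, load_γ hσ, load_δ hσ]
    have hc1 : ((O.game.cost O.α : ℝ≥0) : ℝ≥0∞) = (48 : ℕ) := by simp [game]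
    have hc2 : ((O.game.cost O.γ : ℝ≥0) : ℝ≥0∞) = (12 : ℕ) := by simp [game, n2.symm]
    have hc3 : ((O.game.cost O.δ : ℝ≥0) : ℝ≥0∞) = (60 : ℕ) := by simp [game, n3.symm, n6.symm]
    rw [hc1, hc2, hc3]
    change _ = ((ThreePlayer.cost (O.types σ) i : ℕ) : ℝ≥0∞)
    rw [show O.type (σ i).1 = O.types σ i from rfl]
    unfold ThreePlayer.cost
    generalize hti : O.types σ i = a at hp ⊢
    match a with
    | 0 => simpa using key (m := 48) (k := count (O.types σ) 0 + count (O.types σ) 1) (by omega) (by omega) (by decide)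
    | 1 =>
      have h1 := key (m := 48) (k := count (O.types σ) 0 + count (O.types σ) 1)
        (by omega) (by omega) (by decide)
      have h2 := key (m := 12) (k := count (O.types σ) 1) (by omega) (by omega) (by decide)
      simp [← h1, ← h2]
    | 2 => simpa using key (m := 60) (k := count (O.types σ) 2) (by omega) (by omega) (by decide)
  · intro e _ he
    simp only [Finset.mem_insert, Finset.mem_singleton, not_or] at he
    simp [game, he]

end

theorem fits_of_feasible {σ : O.game.Profile} (h : O.game.Feasible σ) (i : Fin 3) :
    O.Fits (σ i).1 := by
  refine O.fits_of_isPath (σ i).2 fun e he => ?_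
  by_contra hF
  have h0 : 0 < O.game.load σ e := Finset.card_pos.2 ⟨i, by simpa using he⟩
  have h1 := h e
  obtain ⟨p, -, h2, h3, h4, -⟩ := O.exists_β
  obtain ⟨q, -, h5, -, -, -, h6⟩ := O.exists_δ
  have hα : e ≠ O.α := fun h => hF (h ▸ h2 _ h3)
  have hβ : e ≠ O.β := fun h => hF (h ▸ h2 _ h4)
  have hδ : e ≠ O.δ := fun h => hF (h ▸ h5 _ h6)
  rw [show O.game.cap e = 0 by simp [game, hα, hβ, hδ, hF]] at h1
  omega

/-- A profile with prescribed types. -/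
theorem exists_profile (t : Fin 3 → Fin 3) :
    ∃ σ : O.game.Profile, (∀ i, O.Fits (σ i).1) ∧ O.types σ = t := by
  choose p h1 h2 h3 using O.exists_type
  exact ⟨fun i => ⟨p (t i), h1 _⟩, fun i => h2 _, funext fun i => h3 _⟩

theorem not_admits (O : G.Obstruction) : ¬ G.AdmitsSEInSingleSourceGames := by
  intro hG
  obtain ⟨ρ, hρ, hρt⟩ := O.exists_profile ![0, 1, 2]
  have hρf : O.game.Feasible ρ := (feasible_iff hρ).2 (by rw [hρt]; decide +kernel)
  obtain ⟨σ, hσ⟩ := hG 3 O.game ⟨O.x, fun _ => rfl⟩ ⟨ρ, hρf⟩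
  by_cases hf : O.game.Feasible σ
  · have hfit := O.fits_of_feasible hf
    obtain ⟨t, ht, ⟨j, hj⟩, hlt⟩ := exists_deviation _ ((feasible_iff hfit).1 hf)
    obtain ⟨τ, hτ, hτt⟩ := O.exists_profile t
    -- Agents whose type does not change must keep their very path, so that the coalition consists
    -- of those who change type.
    let τ' : O.game.Profile := fun i => if t i = O.types σ i then σ i else τ i
    have hτ' : ∀ i, O.Fits (τ' i).1 := by
      intro i
      by_cases h : t i = O.types σ i
      · simpa [τ', h] using hfit i
      · simpa [τ', h] using hτ i
    have hτt' : O.types τ' = t := by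
      funext i
      by_cases h : t i = O.types σ i
      · simp [types, τ', h]
      · rw [types, show τ' i = τ i from if_neg h]
        exact congrFun hτt i
    have hτf : O.game.Feasible τ' := (feasible_iff hτ').2 (hτt' ▸ ht)
    obtain ⟨k, hk, hle⟩ := hσ (Finset.univ.filter fun i => t i ≠ O.types σ i)
      ⟨j, by simpa using hj⟩ τ' fun i hi => by
        have : t i = O.types σ i := by simpa using hi
        simp [τ', this]
    rw [agentCost_eq hfit hf, agentCost_eq hτ' hτf, hτt', Nat.cast_le] at hle
    exact absurd (hlt k (by simpa using hk)) (not_lt.2 hle)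
  -- An infeasible profile is no equilibrium: the coalition of all agents moves to the feasible ρ,
  -- where all costs are finite.
  · obtain ⟨k, -, hle⟩ := hσ Finset.univ Finset.univ_nonempty ρ fun i hi => absurd (by simp) hi
    rw [agentCost_eq hρ hρf, Game.agentCost, if_neg hf, top_le_iff] at hle
    exact ENNReal.natCast_ne_top _ hle

end Network.Obstruction

/-! ### Layered networks; branching only at hubs makes a network layered -/

namespace Network

variable {G : Network.{u, v}}

/-- A ranking of the nodes together with a set `H` of separating nodes, outside of which all nodes
have exactly one incoming and one outgoing edge. -/
structure Layered (G : Network.{u, v}) (H : Set G.V) (r : G.V → ℕ) : Prop where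
  s_ne_t : G.s ≠ G.t
  lt : ∀ e, r (G.src e) < r (G.tgt e)
  s_mem : G.s ∈ H
  t_mem : G.t ∈ H
  s_le : ∀ x, r G.s ≤ r x
  le_t : ∀ x, r x ≤ r G.t
  eq_of_rank : ∀ h ∈ H, ∀ x, r x = r h → x = h
  le_of_lt : ∀ h ∈ H, ∀ e, r (G.src e) < r h → r (G.tgt e) ≤ r h
  exists_in : ∀ x, x ≠ G.s → ∃ e, G.tgt e = x
  exists_out : ∀ x, x ≠ G.t → ∃ e, G.src e = x
  in_unique : ∀ e f, G.tgt e ∉ H → G.tgt f = G.tgt e → f = e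
  out_unique : ∀ e f, G.src e ∉ H → G.src f = G.src e → f = e

theorem isHub_s : G.IsHub G.s := fun h => h.left_mem rfl

theorem isHub_t : G.IsHub G.t := fun h => h.right_mem rfl

theorem IsHub.mem_nodes {h : G.V} (hh : G.IsHub h) {p : List G.E} (hp : G.IsWalk G.s p G.t) :
    h ∈ G.nodes G.s p := by
  by_contra hn
  exact hh (hp.reachIn fun z hz hz' => hn (by rwa [← show z = h from hz']))

/-- `b` can be reached from `a`. -/
abbrev Reach (G : Network.{u, v}) (a b : G.V) : Prop := G.ReachIn Set.univ a b

theorem IsWalk.reach {a b : G.V} {p : List G.E} (h : G.IsWalk a p b) : G.Reach a b :=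
  h.reachIn fun _ _ => Set.mem_univ _

theorem Reach.edge (e : G.E) : G.Reach (G.src e) (G.tgt e) :=
  .head (Set.mem_univ _) (.refl (Set.mem_univ _))

theorem Reach.eq_or_first {a b : G.V} (h : G.Reach a b) :
    a = b ∨ ∃ e, G.src e = a ∧ G.Reach (G.tgt e) b := by
  obtain ⟨p, h1, -⟩ := h
  cases p with
  | nil => exact .inl h1
  | cons e p => exact .inr ⟨e, h1.1, h1.2.reach⟩

theorem Reach.eq_or_last {a b : G.V} (h : G.Reach a b) :
    a = b ∨ ∃ e, G.tgt e = b ∧ G.Reach a (G.src e) := by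
  obtain ⟨p, h1, -⟩ := h
  rcases List.eq_nil_or_concat' p with rfl | ⟨p, e, rfl⟩
  · exact .inl h1
  · obtain ⟨z, h2, rfl, h3⟩ := isWalk_append.1 h1
    exact .inr ⟨e, h3, h2.reach⟩

/-- Hubs lie on no directed cycle. -/
theorem IsHub.not_reach (hG : G.IsTwoTerminal) {h : G.V} (hh : G.IsHub h) {e : G.E}
    (he : G.src e = h) : ¬ G.Reach (G.tgt e) h := by
  -- Being able to reach the sink without `h` passes from the tail of an edge to its head: if `h`
  -- comes after `f` on a simple path, the part before `f` avoids `h`, and continuing it without `h`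
  -- would contradict that `h` is a hub.
  have step : ∀ f, G.ReachIn {h}ᶜ (G.src f) G.t → G.ReachIn {h}ᶜ (G.tgt f) G.t := by
    intro f hf
    obtain ⟨p, hp, hfp⟩ := hG.edge_mem f
    obtain ⟨p₁, p₂, rfl, h1, h2, hd⟩ := hp.split_edge hfp
    by_cases hm : h ∈ G.nodes (G.tgt f) p₂
    · refine absurd (ReachIn.trans ?_ hf) hh
      exact h1.1.reachIn fun z hz hz' => hd hz (by rwa [show z = h from hz'])
    · exact h2.1.reachIn fun z hz hz' => hm (by rwa [← show z = h from hz'])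
  have first : G.ReachIn {h}ᶜ (G.tgt e) G.t := by
    obtain ⟨p, hp, hep⟩ := hG.edge_mem e
    obtain ⟨p₁, p₂, rfl, h1, h2, hd⟩ := hp.split_edge hep
    refine h2.1.reachIn fun z hz hz' => hd h1.1.end_mem_nodes ?_
    rwa [he, ← show z = h from hz']
  rintro ⟨p, hp, -⟩
  have key : ∀ p z, G.ReachIn {h}ᶜ z G.t → ¬ G.IsWalk z p h := by
    intro p
    induction p with
    | nil => rintro z hz rfl; exact hz.left_mem rfl
    | cons f p ih => rintro z hz ⟨rfl, hw⟩; exact ih _ (step f hz) hw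
  exact key p _ first hp

/-- A cycle through `e` contains no hub, so a walk along it has no choice at any node. It must
follow the rest of a simple path through `e`, which never returns to the tail of `e`. -/
theorem not_reach_of_out_unique (hG : G.IsTwoTerminal)
    (hout : ∀ e f, ¬ G.IsHub (G.src e) → G.src f = G.src e → f = e) (e : G.E) :
    ¬ G.Reach (G.tgt e) (G.src e) := by
  intro hc
  have nohub : ∀ h, G.IsHub h → G.Reach (G.tgt e) h → ¬ G.Reach h (G.src e) := by
    intro h hh h1 h2
    rcases h2.eq_or_first with rfl | ⟨f, hf, h3⟩
    · exact hh.not_reach hG rfl h1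
    · exact hh.not_reach hG hf (h3.trans ((Reach.edge e).trans h1))
  obtain ⟨p, hp, hep⟩ := hG.edge_mem e
  obtain ⟨p₁, p₂, rfl, h1, h2, hd⟩ := hp.split_edge hep
  have key : ∀ q z, z ∈ G.nodes (G.tgt e) p₂ → G.Reach (G.tgt e) z →
      ¬ G.IsWalk z q (G.src e) := by
    intro q
    induction q with
    | nil => rintro z hz - rfl; exact hd h1.1.end_mem_nodes hz
    | cons f q ih =>
      rintro z hz hr ⟨rfl, hw⟩
      have hnh : ¬ G.IsHub (G.src f) := fun hh => nohub _ hh hr ((Reach.edge f).trans hw.reach)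
      obtain ⟨g, hg, hgs⟩ := h2.1.exists_succ hz fun h => hnh (h ▸ isHub_t)
      obtain rfl := hout _ _ hnh hgs
      exact ih _ (tgt_mem_nodes hg) (hr.trans (Reach.edge g)) hw
  obtain ⟨q, hq, -⟩ := hc
  exact key q _ (start_mem_nodes _ _) (.refl (Set.mem_univ _)) hq

theorem IsTwoTerminal.reach_t (hG : G.IsTwoTerminal) (x : G.V) : G.Reach x G.t := by
  obtain ⟨p, hp, hx⟩ := hG.node_mem x
  obtain ⟨p₁, p₂, rfl, h1, h2⟩ := hp.1.split hx
  exact h2.reach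

theorem IsTwoTerminal.s_reach (hG : G.IsTwoTerminal) (x : G.V) : G.Reach G.s x := by
  obtain ⟨p, hp, hx⟩ := hG.node_mem x
  obtain ⟨p₁, p₂, rfl, h1, h2⟩ := hp.1.split hx
  exact h1.reach

/-- A two-terminal network whose nodes other than hubs have no two incoming and no two outgoing
edges is layered by its hubs. -/
theorem IsTwoTerminal.exists_layered [Finite G.V] (hG : G.IsTwoTerminal)
    (hin : ∀ e f, ¬ G.IsHub (G.tgt e) → G.tgt f = G.tgt e → f = e)
    (hout : ∀ e f, ¬ G.IsHub (G.src e) → G.src f = G.src e → f = e) :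
    ∃ H r, G.Layered H r := by
  -- The rank counts the nodes from which `x` can be reached; it is strictly increasing along edges
  -- because there are no cycles.
  let r : G.V → ℕ := fun x => {z | G.Reach z x}.ncard
  have hle : ∀ {a b}, G.Reach a b → r a ≤ r b := fun h =>
    Set.ncard_le_ncard (fun z hz => ReachIn.trans hz h) (Set.toFinite _)
  have hlt : ∀ e, r (G.src e) < r (G.tgt e) := fun e =>
    Set.ncard_lt_ncard (LE.le.ssubset_of_mem_notMem
      (fun z hz => ReachIn.trans hz (Reach.edge e))
      (show G.tgt e ∈ {z | G.Reach z (G.tgt e)} from .refl (Set.mem_univ _))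
      (not_reach_of_out_unique hG hout e)) (Set.toFinite _)
  have hlt' : ∀ {a b}, G.Reach a b → a ≠ b → r a < r b := by
    intro a b h hne
    rcases h.eq_or_first with h | ⟨e, rfl, h'⟩
    · exact absurd h hne
    · exact (hlt e).trans_le (hle h')
  have hcomp : ∀ h, G.IsHub h → ∀ x, G.Reach x h ∨ G.Reach h x := by
    intro h hh x
    obtain ⟨p, hp, hx⟩ := hG.node_mem x
    obtain ⟨p₁, p₂, rfl, h1, h2⟩ := hp.1.split hx
    have := hh.mem_nodes hp.1
    rw [nodes_append] at this
    rcases List.mem_append.1 this with h3 | h3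
    · obtain ⟨q₁, q₂, rfl, h4, h5⟩ := h1.split h3
      exact .inr h5.reach
    · obtain ⟨q₁, q₂, rfl, h4, h5⟩ := h2.split (List.mem_cons_of_mem _ h3)
      exact .inl h4.reach
  refine ⟨{h | G.IsHub h}, r, hG.s_ne_t, hlt, isHub_s, isHub_t, fun x => hle (hG.s_reach x),
    fun x => hle (hG.reach_t x), ?_, ?_, ?_, ?_, hin, hout⟩
  · intro h hh x hx
    by_contra hne
    rcases hcomp h hh x with h1 | h1
    · exact (hlt' h1 hne).ne hx
    · exact (hlt' h1 (Ne.symm hne)).ne' hx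
  · intro h hh e he
    obtain ⟨p, hp, hep⟩ := hG.edge_mem e
    obtain ⟨p₁, p₂, rfl, h1, h2, hd⟩ := hp.split_edge hep
    have := hh.mem_nodes hp.1
    rw [nodes_append_cons] at this
    rcases List.mem_append.1 this with h3 | h3
    · obtain ⟨q₁, q₂, rfl, h4, h5⟩ := h1.1.split h3
      exact absurd (hle h5.reach) (not_le.2 he)
    · obtain ⟨q₁, q₂, rfl, h4, h5⟩ := h2.1.split h3
      exact hle h4.reach
  · intro x hx
    rcases (hG.s_reach x).eq_or_last with h | ⟨e, h, -⟩
    · exact absurd h.symm hx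
    · exact ⟨e, h⟩
  · intro x hx
    rcases (hG.reach_t x).eq_or_first with h | ⟨e, h, -⟩
    · exact absurd h hx
    · exact ⟨e, h⟩

/-- A finite two-terminal network in which strong equilibria exist is layered. -/
theorem AdmitsSEInSingleSourceGames.exists_layered [Finite G.V] (hG : G.IsTwoTerminal)
    (h : G.AdmitsSEInSingleSourceGames) : ∃ H r, G.Layered H r := by
  refine hG.exists_layered (fun e f hv hs => ?_) fun e f hv hs => ?_
  · by_contra hne
    obtain ⟨O⟩ := obstruction_of_in hG (Ne.symm hne) hs hv
    exact O.not_admits h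
  · by_contra hne
    obtain ⟨O⟩ := obstruction_of_out hG (Ne.symm hne) hs hv
    exact O.not_admits h

end Network

/-! ### Decomposition of layered networks into series of parallel paths -/

namespace Network

section Iso

variable {G : Network.{u, v}} {H : Network.{u', v'}} {K : Network.{u'', v''}}

/-- The identity isomorphism. -/
def Iso.refl (G : Network.{u, v}) : Iso G G :=
  ⟨.refl _, .refl _, fun _ => rfl, fun _ => rfl, rfl, rfl⟩

/-- The inverse isomorphism. -/
def Iso.symm (i : Iso G H) : Iso H G where
  onV := i.onV.symm
  onE := i.onE.symm
  src_comm e := by rw [Equiv.eq_symm_apply, ← i.src_comm, Equiv.apply_symm_apply]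
  tgt_comm e := by rw [Equiv.eq_symm_apply, ← i.tgt_comm, Equiv.apply_symm_apply]
  map_s := by rw [Equiv.symm_apply_eq, i.map_s]
  map_t := by rw [Equiv.symm_apply_eq, i.map_t]

/-- An embedding of directed multigraphs, disregarding the designated nodes. -/
structure Emb (K : Network.{u', v'}) (G : Network.{u, v}) where
  onV : K.V → G.V
  onE : K.E → G.E
  injV : Function.Injective onV
  injE : Function.Injective onE
  src_comm : ∀ e, G.src (onE e) = onV (K.src e)
  tgt_comm : ∀ e, G.tgt (onE e) = onV (K.tgt e)

/-- An embedding precomposed with an isomorphism. -/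
def Emb.ofIso (f : Emb K G) (i : Iso H K) : Emb H G where
  onV := f.onV ∘ i.onV
  onE := f.onE ∘ i.onE
  injV := f.injV.comp i.onV.injective
  injE := f.injE.comp i.onE.injective
  src_comm e := by simp [f.src_comm, i.src_comm]
  tgt_comm e := by simp [f.tgt_comm, i.tgt_comm]

/-- Both compositions are quotients of a disjoint union by a relation that need not be an
equivalence. Since `R` relates precisely the pairs with a common image and both maps are injective,
its closure never has to be computed. -/
theorem quot_lift_bijective {A : Type u} {B : Type u'} {C : Type u''} {f : A → C} {g : B → C}
    (hf : Function.Injective f) (hg : Function.Injective g) {R : A ⊕ B → A ⊕ B → Prop}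
    (hR : ∀ x y, R x y → ∃ a b, x = .inl a ∧ y = .inr b ∧ f a = g b)
    (hR' : ∀ a b, f a = g b → R (.inl a) (.inr b)) (hc : ∀ z, (∃ a, f a = z) ∨ ∃ b, g b = z) :
    ∃ φ : Quot R ≃ C, (∀ a, φ (Quot.mk _ (.inl a)) = f a) ∧ ∀ b, φ (Quot.mk _ (.inr b)) = g b := by
  let F : Quot R → C := Quot.lift (Sum.elim f g) fun x y h => by
    obtain ⟨a, b, rfl, rfl, h'⟩ := hR x y h
    exact h'
  have hF : F.Bijective := by
    constructor
    · rintro ⟨a | b⟩ ⟨a' | b'⟩ h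
      · exact congrArg _ (congrArg _ (hf h))
      · exact Quot.sound (hR' _ _ h)
      · exact (Quot.sound (hR' _ _ (Eq.symm h))).symm
      · exact congrArg _ (congrArg _ (hg h))
    · intro z
      rcases hc z with ⟨a, rfl⟩ | ⟨b, rfl⟩
      · exact ⟨Quot.mk _ (.inl a), rfl⟩
      · exact ⟨Quot.mk _ (.inr b), rfl⟩
  exact ⟨Equiv.ofBijective F hF, fun _ => rfl, fun _ => rfl⟩

theorem sum_elim_bijective {A : Type u} {B : Type u'} {C : Type u''} {f : A → C} {g : B → C}
    (hf : Function.Injective f) (hg : Function.Injective g) (hd : ∀ a b, f a ≠ g b)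
    (hc : ∀ z, (∃ a, f a = z) ∨ ∃ b, g b = z) : (Sum.elim f g).Bijective := by
  refine ⟨hf.sumElim hg hd, fun z => ?_⟩
  rcases hc z with ⟨a, rfl⟩ | ⟨b, rfl⟩
  · exact ⟨.inl a, rfl⟩
  · exact ⟨.inr b, rfl⟩

end Iso

section Glue

variable {G H K : Network.{u, v}} (f : Emb H G) (g : Emb K G)
    (hE : ∀ a b, f.onE a ≠ g.onE b) (hE' : ∀ z, (∃ a, f.onE a = z) ∨ ∃ b, g.onE b = z)
    (hV' : ∀ z, (∃ a, f.onV a = z) ∨ ∃ b, g.onV b = z)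

include hE hE' hV'

theorem iso_series_of_emb (hs : f.onV H.s = G.s) (ht : g.onV K.t = G.t)
    (hV : ∀ a b, f.onV a = g.onV b ↔ a = H.t ∧ b = K.s) : Nonempty (Iso G (series H K)) := by
  obtain ⟨φ, h1, h2⟩ := quot_lift_bijective f.injV g.injV
    (R := fun a b : H.V ⊕ K.V => a = Sum.inl H.t ∧ b = Sum.inr K.s)
    (by rintro _ _ ⟨rfl, rfl⟩; exact ⟨_, _, rfl, rfl, (hV _ _).2 ⟨rfl, rfl⟩⟩)
    (by intro a b h; obtain ⟨rfl, rfl⟩ := (hV _ _).1 h; exact ⟨rfl, rfl⟩) hV'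
  refine ⟨Iso.symm ⟨φ, Equiv.ofBijective _ (sum_elim_bijective f.injE g.injE hE hE'),
    ?_, ?_, (h1 _).trans hs, (h2 _).trans ht⟩⟩
  · rintro (e | e)
    · exact (f.src_comm e).trans (h1 _).symm
    · exact (g.src_comm e).trans (h2 _).symm
  · rintro (e | e)
    · exact (f.tgt_comm e).trans (h1 _).symm
    · exact (g.tgt_comm e).trans (h2 _).symm

theorem iso_parallel_of_emb (hs : f.onV H.s = G.s) (ht : f.onV H.t = G.t)
    (hV : ∀ a b, f.onV a = g.onV b ↔ (a = H.s ∧ b = K.s) ∨ (a = H.t ∧ b = K.t)) :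
    Nonempty (Iso G (parallel H K)) := by
  obtain ⟨φ, h1, h2⟩ := quot_lift_bijective f.injV g.injV
    (R := fun a b : H.V ⊕ K.V => (a = Sum.inl H.s ∧ b = Sum.inr K.s) ∨
      (a = Sum.inl H.t ∧ b = Sum.inr K.t))
    (by
      rintro _ _ (⟨rfl, rfl⟩ | ⟨rfl, rfl⟩)
      · exact ⟨_, _, rfl, rfl, (hV _ _).2 (.inl ⟨rfl, rfl⟩)⟩
      · exact ⟨_, _, rfl, rfl, (hV _ _).2 (.inr ⟨rfl, rfl⟩)⟩)
    (by
      intro a b h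
      rcases (hV _ _).1 h with ⟨rfl, rfl⟩ | ⟨rfl, rfl⟩
      · exact .inl ⟨rfl, rfl⟩
      · exact .inr ⟨rfl, rfl⟩) hV'
  refine ⟨Iso.symm ⟨φ, Equiv.ofBijective _ (sum_elim_bijective f.injE g.injE hE hE'),
    ?_, ?_, (h1 _).trans hs, (h1 _).trans ht⟩⟩
  · rintro (e | e)
    · exact (f.src_comm e).trans (h1 _).symm
    · exact (g.src_comm e).trans (h2 _).symm
  · rintro (e | e)
    · exact (f.tgt_comm e).trans (h1 _).symm
    · exact (g.tgt_comm e).trans (h2 _).symm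

end Glue

variable {G : Network.{u, v}}

/-- The subnetwork with nodes `P` and edges `Q`. -/
abbrev sub (G : Network.{u, v}) (P : Set G.V) (Q : Set G.E)
    (h : ∀ e ∈ Q, G.src e ∈ P ∧ G.tgt e ∈ P) (s t : P) : Network.{u, v} where
  V := P
  E := Q
  src e := ⟨G.src e.1, (h e.1 e.2).1⟩
  tgt e := ⟨G.tgt e.1, (h e.1 e.2).2⟩
  s := s
  t := t

/-- The inclusion of a subnetwork. -/
def subEmb {P : Set G.V} {Q : Set G.E} (h : ∀ e ∈ Q, G.src e ∈ P ∧ G.tgt e ∈ P) (s t : P) :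
    Emb (G.sub P Q h s t) G where
  onV := Subtype.val
  onE := Subtype.val
  injV := Subtype.val_injective
  injE := Subtype.val_injective
  src_comm _ := rfl
  tgt_comm _ := rfl

namespace Layered

variable {H : Set G.V} {r : G.V → ℕ} (L : G.Layered H r)
include L

theorem rank_le_of_mem {x y z : G.V} {p : List G.E} (h : G.IsWalk x p y) (hz : z ∈ G.nodes x p) :
    r x ≤ r z ∧ r z ≤ r y := by
  induction p generalizing x z with
  | nil =>
    obtain rfl : z = x := by simpa [nodes] using hz
    obtain rfl : z = y := h
    simp
  | cons e p ih =>
    obtain ⟨rfl, h⟩ := h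
    have := L.lt e
    rw [nodes_cons] at hz
    rcases List.mem_cons.1 hz with rfl | hz
    · have := ih h (start_mem_nodes _ _)
      omega
    · have := ih h hz
      omega

theorem isPath {x y : G.V} {p : List G.E} (h : G.IsWalk x p y) : G.IsPath x p y := by
  refine ⟨h, ?_⟩
  induction p generalizing x with
  | nil => simp [nodes]
  | cons e p ih =>
    obtain ⟨rfl, h⟩ := h
    rw [nodes_cons, List.nodup_cons]
    exact ⟨fun hm => absurd (L.rank_le_of_mem h hm).1 (not_le.2 (L.lt e)), ih h⟩

theorem reach_t (x : G.V) : ∃ p, G.IsWalk x p G.t := by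
  induction hn : r G.t - r x using Nat.strong_induction_on generalizing x with
  | _ n ih =>
    by_cases hx : x = G.t
    · exact ⟨[], hx⟩
    · obtain ⟨e, rfl⟩ := L.exists_out x hx
      have h1 := L.lt e
      have h2 := L.le_t (G.tgt e)
      obtain ⟨p, hp⟩ := ih (r G.t - r (G.tgt e)) (by omega) _ rfl
      exact ⟨e :: p, rfl, hp⟩

theorem src_ne_t (e : G.E) : G.src e ≠ G.t := fun h => by
  have h1 := L.lt e
  have h2 := L.le_t (G.tgt e)
  rw [h] at h1
  omega

theorem tgt_ne_s (e : G.E) : G.tgt e ≠ G.s := fun h => by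
  have h1 := L.lt e
  have h2 := L.s_le (G.src e)
  rw [h] at h1
  omega

end Layered

/-- A layered network that cannot be split any further in series. -/
abbrev IsBlock (G : Network.{u, v}) (r : G.V → ℕ) : Prop := G.Layered {G.s, G.t} r

namespace IsBlock

variable {r : G.V → ℕ} (L : G.IsBlock r)
include L

theorem src_notMem {e : G.E} (h : G.src e ≠ G.s) : G.src e ∉ ({G.s, G.t} : Set G.V) := by
  rintro (h' | h')
  · exact h h'
  · exact Layered.src_ne_t L e h'

theorem tgt_notMem {e : G.E} (h : G.tgt e ≠ G.t) : G.tgt e ∉ ({G.s, G.t} : Set G.V) := by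
  rintro (h' | h')
  · exact Layered.tgt_ne_s L e h'
  · exact h h'

/-- By induction on the rank, the edge before `e` lies on the path, and the node between them has
`e` as its only exit. -/
theorem mem_path {p : List G.E} (hp : G.IsWalk G.s p G.t) (hs : ∀ e, G.src e = G.s → e ∈ p)
    (e : G.E) : e ∈ p := by
  induction hn : r (G.src e) using Nat.strong_induction_on generalizing e with
  | _ n ih =>
    by_cases he : G.src e = G.s
    · exact hs e he
    · obtain ⟨f, hf⟩ := L.exists_in _ he
      have hfp := ih (r (G.src f)) (by rw [← hn, ← hf]; exact L.lt f) f rfl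
      obtain ⟨g, hg, hgs⟩ := hp.exists_succ (tgt_mem_nodes hfp) (hf ▸ Layered.src_ne_t L e)
      rw [hf] at hgs
      rwa [← L.out_unique e g (src_notMem L he) hgs]

theorem isSimplePath (hu : ∀ e f, G.src e = G.s → G.src f = G.s → e = f) : G.IsSimplePath := by
  classical
  obtain ⟨p, hp⟩ := Layered.reach_t L G.s
  have hmem : ∀ e, e ∈ p := by
    refine mem_path L hp fun e he => ?_
    obtain ⟨f, hf, hfs⟩ := hp.exists_succ (start_mem_nodes _ _) L.s_ne_t
    rwa [hu e f he hfs]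
  have hnodes : ∀ x, x ∈ G.nodes G.s p := by
    intro x
    by_cases hx : x = G.s
    · exact hx ▸ start_mem_nodes _ _
    · obtain ⟨e, rfl⟩ := L.exists_in x hx
      exact tgt_mem_nodes (hmem e)
  have hpath := Layered.isPath L hp
  obtain ⟨m, hm⟩ : ∃ m, p.length = m + 1 := by
    cases p with
    | nil => exact absurd hp L.s_ne_t
    | cons e p => exact ⟨p.length, rfl⟩
  have hm' : (G.nodes G.s p).length = m + 2 := by simp [nodes, hm]
  have hsrc : ∀ (p : List G.E) (x y : G.V), G.IsWalk x p y → ∀ (i : ℕ) (hi : i < p.length),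
      G.src p[i] = (G.nodes x p)[i]'(by simp [nodes]; omega) := by
    intro p
    induction p with
    | nil => intro x y _ i hi; simp at hi
    | cons e p ih =>
      rintro x y ⟨rfl, hw⟩ i hi
      cases i with
      | zero => simp [nodes]
      | succ i => simpa [nodes] using ih _ _ hw i (by simpa using hi)
  have hlast : ∀ (p : List G.E) (x y : G.V), G.IsWalk x p y →
      (G.nodes x p)[p.length]'(by simp [nodes]) = y := by
    intro p
    induction p with
    | nil => intro x y h; exact h
    | cons e p ih =>
      rintro x y ⟨rfl, hw⟩
      simpa [nodes] using ih _ _ hw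
  refine ⟨m, ⟨Iso.symm ⟨(finCongr hm'.symm).trans
    (hpath.2.getEquivOfForallMemList _ hnodes), (finCongr hm.symm).trans
    (hpath.edges_nodup.getEquivOfForallMemList _ hmem), ?_, ?_, ?_, ?_⟩⟩⟩
  · intro i
    exact hsrc p _ _ hp i.1 (by omega)
  · intro i
    have : ∀ (j : ℕ) (hj : j < p.length),
        G.tgt p[j] = (G.nodes G.s p)[j + 1]'(by simpa [nodes] using hj) := by simp [nodes]
    exact this i.1 (lt_of_lt_of_eq i.2 hm.symm)
  · rfl
  · have := hlast p _ _ hp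
    simp only [hm] at this
    exact this

/-- Peel off a path `p`. Inner nodes have a single edge in and out, so an edge off `p` can start on
`p` only at the source and end on `p` only at the sink. The edges off `p` thus form a smaller block,
unless all edges at the source lie on `p`; then the block is a simple path. -/
theorem isParallelPaths [Finite G.E] : G.IsParallelPaths := by
  induction hn : Nat.card G.E using Nat.strong_induction_on generalizing G with
  | _ n ih =>
    obtain ⟨p, hp⟩ := Layered.reach_t L G.s
    have hpath := Layered.isPath L hp
    by_cases hall : ∀ e, G.src e = G.s → e ∈ p
    · refine ⟨G, [], ?_, ⟨.refl G⟩⟩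
      simp only [List.mem_singleton, forall_eq]
      exact isSimplePath L fun e f he hf => hpath.eq_of_src (hall e he) (hall f hf)
        (he.trans hf.symm)
    push Not at hall
    obtain ⟨e₀, he₀, he₀p⟩ := hall
    have hsrc : ∀ e, e ∉ p → G.src e ∈ G.nodes G.s p → G.src e = G.s := by
      intro e he hm
      by_contra hs
      obtain ⟨g, hg, hgs⟩ := hp.exists_succ hm (Layered.src_ne_t L e)
      exact he (L.out_unique e g (src_notMem L hs) hgs ▸ hg)
    have htgt : ∀ e, e ∉ p → G.tgt e ∈ G.nodes G.s p → G.tgt e = G.t := by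
      intro e he hm
      by_contra ht
      obtain ⟨g, hg, hgs⟩ := IsWalk.exists_pred hm (Layered.tgt_ne_s L e)
      exact he (L.in_unique e g (tgt_notMem L ht) hgs ▸ hg)
    -- Following `e₀` forwards never leads onto an inner node of `p`, so some edge off `p` enters
    -- the sink. The remaining block needs it.
    obtain ⟨e₁, he₁, he₁p⟩ : ∃ e, G.tgt e = G.t ∧ e ∉ p := by
      have : ∀ k e, r G.t - r (G.tgt e) = k → e ∉ p → ∃ e, G.tgt e = G.t ∧ e ∉ p := by
        intro k
        induction k using Nat.strong_induction_on with
        | _ k ih =>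
          intro e hk he
          by_cases ht : G.tgt e = G.t
          · exact ⟨e, ht, he⟩
          · obtain ⟨f, hf⟩ := L.exists_out _ ht
            have h1 := L.lt f
            have h2 := L.le_t (G.tgt f)
            rw [hf] at h1
            refine ih _ (by omega) f rfl fun hfp => ht (htgt e he ?_)
            exact hf ▸ hp.src_mem_nodes hfp
      exact this _ e₀ rfl he₀p
    have hsp : G.s ∈ G.nodes G.s p := start_mem_nodes _ _
    have htp : G.t ∈ G.nodes G.s p := hp.end_mem_nodes
    let P₁ : Set G.V := {x | x ∈ G.nodes G.s p → x = G.s ∨ x = G.t}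
    let G₁ := G.sub P₁ {e | e ∉ p}
      (fun e he => ⟨fun h => .inl (hsrc e he h), fun h => .inr (htgt e he h)⟩)
      ⟨G.s, fun _ => .inl rfl⟩ ⟨G.t, fun _ => .inr rfl⟩
    let G₂ := G.sub {x | x ∈ G.nodes G.s p} {e | e ∈ p}
      (fun e he => ⟨hp.src_mem_nodes he, tgt_mem_nodes he⟩) ⟨G.s, hsp⟩ ⟨G.t, htp⟩
    have L₁ : G₁.IsBlock fun x => r x.1 := by
      refine ⟨fun h => L.s_ne_t (congrArg Subtype.val h), fun e => L.lt e.1, .inl rfl, .inr rfl,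
        fun x => L.s_le x.1, fun x => L.le_t x.1, ?_, ?_, ?_, ?_, ?_, ?_⟩
      · rintro h (rfl | rfl) x hx
        · exact Subtype.ext (L.eq_of_rank _ L.s_mem _ hx)
        · exact Subtype.ext (L.eq_of_rank _ L.t_mem _ hx)
      · rintro h (rfl | rfl) e he
        · exact L.le_of_lt _ L.s_mem _ he
        · exact L.le_of_lt _ L.t_mem _ he
      · rintro ⟨x, hxP⟩ hx
        by_cases hxp : x ∈ G.nodes G.s p
        · rcases hxP hxp with rfl | rfl
          · exact absurd rfl hx
          · exact ⟨⟨e₁, he₁p⟩, Subtype.ext he₁⟩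
        · obtain ⟨e, rfl⟩ := L.exists_in x fun h => hxp (h ▸ hsp)
          exact ⟨⟨e, fun he => hxp (tgt_mem_nodes he)⟩, rfl⟩
      · rintro ⟨x, hxP⟩ hx
        by_cases hxp : x ∈ G.nodes G.s p
        · rcases hxP hxp with rfl | rfl
          · exact ⟨⟨e₀, he₀p⟩, Subtype.ext he₀⟩
          · exact absurd rfl hx
        · obtain ⟨e, rfl⟩ := L.exists_out x fun h => hxp (h ▸ htp)
          exact ⟨⟨e, fun he => hxp (hp.src_mem_nodes he)⟩, rfl⟩
      · intro e f he hfe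
        refine Subtype.ext (L.in_unique e.1 f.1 (fun h => he ?_) (congrArg Subtype.val hfe))
        exact h.imp Subtype.ext Subtype.ext
      · intro e f he hfe
        refine Subtype.ext (L.out_unique e.1 f.1 (fun h => he ?_) (congrArg Subtype.val hfe))
        exact h.imp Subtype.ext Subtype.ext
    have L₂ : G₂.IsBlock fun x => r x.1 := by
      refine ⟨fun h => L.s_ne_t (congrArg Subtype.val h), fun e => L.lt e.1, .inl rfl, .inr rfl,
        fun x => L.s_le x.1, fun x => L.le_t x.1, ?_, ?_, ?_, ?_, ?_, ?_⟩
      · rintro h (rfl | rfl) x hx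
        · exact Subtype.ext (L.eq_of_rank _ L.s_mem _ hx)
        · exact Subtype.ext (L.eq_of_rank _ L.t_mem _ hx)
      · rintro h (rfl | rfl) e he
        · exact L.le_of_lt _ L.s_mem _ he
        · exact L.le_of_lt _ L.t_mem _ he
      · rintro ⟨x, hxp⟩ hx
        obtain ⟨e, he, rfl⟩ := IsWalk.exists_pred hxp fun h => hx (Subtype.ext h)
        exact ⟨⟨e, he⟩, rfl⟩
      · rintro ⟨x, hxp⟩ hx
        obtain ⟨e, he, rfl⟩ := hp.exists_succ hxp fun h => hx (Subtype.ext h)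
        exact ⟨⟨e, he⟩, rfl⟩
      · intro e f he hfe
        refine Subtype.ext (L.in_unique e.1 f.1 (fun h => he ?_) (congrArg Subtype.val hfe))
        exact h.imp Subtype.ext Subtype.ext
      · intro e f he hfe
        refine Subtype.ext (L.out_unique e.1 f.1 (fun h => he ?_) (congrArg Subtype.val hfe))
        exact h.imp Subtype.ext Subtype.ext
    have hG₂ : G₂.IsSimplePath := isSimplePath L₂ fun e f he hf =>
      Subtype.ext (hpath.eq_of_src e.2 f.2 (congrArg Subtype.val (he.trans hf.symm)))
    obtain ⟨f₀, hf₀, -⟩ := hp.exists_succ hsp L.s_ne_t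
    obtain ⟨Q, M, hQ, ⟨i⟩⟩ := ih (Nat.card G₁.E)
      (hn ▸ Finite.card_subtype_lt (x := f₀) (not_not.2 hf₀)) L₁ rfl
    refine ⟨Q, M ++ [G₂], ?_, ?_⟩
    · rw [← List.cons_append]
      intro R hR
      rcases List.mem_append.1 hR with hR | hR
      · exact hQ R hR
      · exact List.mem_singleton.1 hR ▸ hG₂
    · rw [List.foldl_append]
      refine iso_parallel_of_emb ((subEmb _ _ _ : Emb G₁ G).ofIso i.symm) (subEmb _ _ _ : Emb G₂ G)
        ?_ ?_ ?_ ?_ ?_ ?_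
      · intro a b h
        exact (i.symm.onE a).2 ((show (i.symm.onE a).1 = b.1 from h) ▸ b.2)
      · intro z
        by_cases hz : z ∈ p
        · exact .inr ⟨⟨z, hz⟩, rfl⟩
        · exact .inl ⟨i.onE ⟨z, hz⟩, congrArg Subtype.val (i.onE.symm_apply_apply _)⟩
      · intro z
        by_cases hz : z ∈ G.nodes G.s p
        · exact .inr ⟨⟨z, hz⟩, rfl⟩
        · exact .inl ⟨i.onV ⟨z, fun h => absurd h hz⟩,
            congrArg Subtype.val (i.onV.symm_apply_apply _)⟩
      · exact congrArg Subtype.val i.symm.map_s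
      · exact congrArg Subtype.val i.symm.map_t
      · intro a b
        constructor
        · intro h
          have h' : (i.symm.onV a).1 = b.1 := h
          rcases (i.symm.onV a).2 (h' ▸ b.2) with h1 | h1
          · refine .inl ⟨i.symm.onV.injective (Subtype.ext (h1.trans ?_)),
              Subtype.ext (h'.symm.trans h1)⟩
            exact (congrArg Subtype.val i.symm.map_s).symm
          · refine .inr ⟨i.symm.onV.injective (Subtype.ext (h1.trans ?_)),
              Subtype.ext (h'.symm.trans h1)⟩
            exact (congrArg Subtype.val i.symm.map_t).symm
        · rintro (⟨rfl, rfl⟩ | ⟨rfl, rfl⟩)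
          · exact congrArg Subtype.val i.symm.map_s
          · exact congrArg Subtype.val i.symm.map_t

end IsBlock

/-- A finite layered network is a series of parallel paths. -/
theorem Layered.isSPP [Finite G.V] [Finite G.E] {H : Set G.V} {r : G.V → ℕ} (L : G.Layered H r) :
    G.IsSPP := by
  induction hn : Nat.card G.E using Nat.strong_induction_on generalizing G with
  | _ n ih =>
    by_cases hH : H ⊆ {G.s, G.t}
    · obtain rfl : H = {G.s, G.t} := hH.antisymm fun x hx => by
        rcases hx with rfl | rfl
        · exact L.s_mem
        · exact L.t_mem
      refine ⟨G, [], ?_, ⟨.refl G⟩⟩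
      simp only [List.mem_singleton, forall_eq]
      exact IsBlock.isParallelPaths L
    -- The inner separating node of largest rank cuts off the last block, in keeping with `foldl`,
    -- which appends on the right.
    obtain ⟨w, ⟨hwH, hwst⟩, hmax⟩ := Set.exists_max_image (H \ {G.s, G.t}) r (Set.toFinite _)
      (by rwa [Set.sdiff_nonempty])
    have hws : w ≠ G.s := fun h => hwst (.inl h)
    have hwt : w ≠ G.t := fun h => hwst (.inr h)
    have hwt' : r w < r G.t := (L.le_t w).lt_of_ne fun h => hwt (L.eq_of_rank _ L.t_mem _ h)
    have hws' : r G.s < r w := (L.s_le w).lt_of_ne fun h => hws (L.eq_of_rank _ L.s_mem _ h.symm)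
    let G₁ := G.sub {x | r x ≤ r w} {e | r (G.tgt e) ≤ r w}
      (fun e he => ⟨(L.lt e).le.trans he, he⟩) ⟨G.s, hws'.le⟩ ⟨w, le_refl (r w)⟩
    let G₂ := G.sub {x | r w ≤ r x} {e | r w ≤ r (G.src e)}
      (fun e he => ⟨he, he.trans (L.lt e).le⟩) ⟨w, le_refl (r w)⟩ ⟨G.t, hwt'.le⟩
    have L₁ : G₁.Layered {x | x.1 ∈ H} fun x => r x.1 := by
      refine ⟨fun h => hws (congrArg Subtype.val h).symm, fun e => L.lt e.1, L.s_mem, hwH,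
        fun x => L.s_le x.1, fun x => x.2, fun h hh x hx => Subtype.ext (L.eq_of_rank _ hh _ hx),
        fun h hh e he => L.le_of_lt _ hh _ he, ?_, ?_,
        fun e f he hfe => Subtype.ext (L.in_unique e.1 f.1 he (congrArg Subtype.val hfe)),
        fun e f he hfe => Subtype.ext (L.out_unique e.1 f.1 he (congrArg Subtype.val hfe))⟩
      · rintro ⟨x, hxw⟩ hx
        obtain ⟨e, rfl⟩ := L.exists_in x fun h => hx (Subtype.ext h)
        exact ⟨⟨e, hxw⟩, rfl⟩
      · rintro ⟨x, hxw⟩ hx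
        have hne : x ≠ w := fun h => hx (Subtype.ext h)
        obtain ⟨e, rfl⟩ := L.exists_out x fun h => by
          rw [h] at hxw
          exact absurd hxw (not_le.2 hwt')
        refine ⟨⟨e, L.le_of_lt _ hwH _ (lt_of_le_of_ne hxw fun h => ?_)⟩, rfl⟩
        exact hne (L.eq_of_rank _ hwH _ h)
    have L₂ : G₂.IsBlock fun x => r x.1 := by
      have hblock : ∀ x : G₂.V, x.1 ∈ H → x ∈ ({G₂.s, G₂.t} : Set G₂.V) := by
        rintro ⟨x, hxw⟩ hx
        by_cases hxt : x = G.t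
        · exact .inr (Subtype.ext hxt)
        · refine .inl (Subtype.ext (L.eq_of_rank _ hwH _ ((hmax x ⟨hx, ?_⟩).antisymm hxw)))
          rintro (h | h)
          · rw [h] at hxw
            exact absurd hxw (not_le.2 hws')
          · exact hxt h
      have hblock' : ∀ x ∈ ({G₂.s, G₂.t} : Set G₂.V), x.1 ∈ H := by
        rintro x (rfl | rfl)
        · exact hwH
        · exact L.t_mem
      refine ⟨fun h => hwt (congrArg Subtype.val h), fun e => L.lt e.1, .inl rfl, .inr rfl,
        fun x => x.2, fun x => L.le_t x.1,
        fun h hh x hx => Subtype.ext (L.eq_of_rank _ (hblock' h hh) _ hx),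
        fun h hh e he => L.le_of_lt _ (hblock' h hh) _ he, ?_, ?_,
        fun e f he hfe => Subtype.ext (L.in_unique e.1 f.1 (fun h => he (hblock _ h))
          (congrArg Subtype.val hfe)),
        fun e f he hfe => Subtype.ext (L.out_unique e.1 f.1 (fun h => he (hblock _ h))
          (congrArg Subtype.val hfe))⟩
      · rintro ⟨x, hxw⟩ hx
        have hne : x ≠ w := fun h => hx (Subtype.ext h)
        obtain ⟨e, rfl⟩ := L.exists_in x fun h => by
          rw [h] at hxw
          exact absurd hxw (not_le.2 hws')
        refine ⟨⟨e, ?_⟩, rfl⟩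
        by_contra hlt
        refine hne (L.eq_of_rank _ hwH _ (le_antisymm (L.le_of_lt _ hwH _ (not_le.1 hlt)) hxw))
      · rintro ⟨x, hxw⟩ hx
        obtain ⟨e, rfl⟩ := L.exists_out x fun h => hx (Subtype.ext h)
        exact ⟨⟨e, hxw⟩, rfl⟩
    obtain ⟨e₁, he₁⟩ := L.exists_in _ L.s_ne_t.symm
    obtain ⟨Q, M, hQ, ⟨i⟩⟩ := ih (Nat.card G₁.E)
      (hn ▸ Finite.card_subtype_lt (x := e₁) (by
        simp only [Set.mem_ofPred_eq, he₁, not_le]; exact hwt')) L₁ rfl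
    refine ⟨Q, M ++ [G₂], ?_, ?_⟩
    · rw [← List.cons_append]
      intro R hR
      rcases List.mem_append.1 hR with hR | hR
      · exact hQ R hR
      · exact List.mem_singleton.1 hR ▸ IsBlock.isParallelPaths L₂
    · rw [List.foldl_append]
      refine iso_series_of_emb ((subEmb _ _ _ : Emb G₁ G).ofIso i.symm) (subEmb _ _ _ : Emb G₂ G)
        ?_ ?_ ?_ ?_ rfl ?_
      · intro a b h
        have h1 := (i.symm.onE a).2
        have h2 := b.2
        rw [show (i.symm.onE a).1 = b.1 from h] at h1
        exact absurd (h2.trans_lt (L.lt b.1)) (not_lt.2 h1)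
      · intro z
        by_cases hz : r w ≤ r (G.src z)
        · exact .inr ⟨⟨z, hz⟩, rfl⟩
        · exact .inl ⟨i.onE ⟨z, L.le_of_lt _ hwH _ (not_le.1 hz)⟩,
            congrArg Subtype.val (i.onE.symm_apply_apply _)⟩
      · intro z
        rcases le_total (r w) (r z) with hz | hz
        · exact .inr ⟨⟨z, hz⟩, rfl⟩
        · exact .inl ⟨i.onV ⟨z, hz⟩, congrArg Subtype.val (i.onV.symm_apply_apply _)⟩
      · exact congrArg Subtype.val i.symm.map_s
      · intro a b
        constructor
        · intro h
          have h' : (i.symm.onV a).1 = b.1 := h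
          have h1 : b.1 = w := L.eq_of_rank _ hwH _ (le_antisymm (h' ▸ (i.symm.onV a).2) b.2)
          refine ⟨i.symm.onV.injective (Subtype.ext ((h'.trans h1).trans ?_)), Subtype.ext h1⟩
          exact (congrArg Subtype.val i.symm.map_t).symm
        · rintro ⟨rfl, rfl⟩
          exact congrArg Subtype.val i.symm.map_t

end Network

/-! ### Series of parallel paths are layered -/

namespace Network

theorem Layered.ofIso {G : Network.{u, v}} {K : Network.{u', v'}} {H : Set K.V} {r : K.V → ℕ}
    (L : K.Layered H r) (i : Iso G K) : G.Layered {x | i.onV x ∈ H} fun x => r (i.onV x) where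
  s_ne_t h := L.s_ne_t (by rw [← i.map_s, h, i.map_t])
  lt e := by
    rw [← i.src_comm, ← i.tgt_comm]
    exact L.lt _
  s_mem := by
    have := L.s_mem
    rwa [← i.map_s] at this
  t_mem := by
    have := L.t_mem
    rwa [← i.map_t] at this
  s_le x := i.map_s.symm ▸ L.s_le _
  le_t x := i.map_t.symm ▸ L.le_t _
  eq_of_rank h hh x hx := i.onV.injective (L.eq_of_rank _ hh _ hx)
  le_of_lt h hh e he := by
    rw [← i.tgt_comm]
    refine L.le_of_lt _ hh _ ?_
    rwa [i.src_comm]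
  exists_in x hx := by
    obtain ⟨e, he⟩ := L.exists_in (i.onV x) fun h => hx (i.onV.injective (h.trans i.map_s.symm))
    refine ⟨i.onE.symm e, i.onV.injective ?_⟩
    rw [← i.tgt_comm, Equiv.apply_symm_apply, he]
  exists_out x hx := by
    obtain ⟨e, he⟩ := L.exists_out (i.onV x) fun h => hx (i.onV.injective (h.trans i.map_t.symm))
    refine ⟨i.onE.symm e, i.onV.injective ?_⟩
    rw [← i.src_comm, Equiv.apply_symm_apply, he]
  in_unique e f he hfe := by
    refine i.onE.injective (L.in_unique _ _ ?_ ?_)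
    · rw [i.tgt_comm]; exact he
    · rw [i.tgt_comm, i.tgt_comm, hfe]
  out_unique e f he hfe := by
    refine i.onE.injective (L.out_unique _ _ ?_ ?_)
    · rw [i.src_comm]; exact he
    · rw [i.src_comm, i.src_comm, hfe]

theorem IsBlock.ofIso {G : Network.{u, v}} {K : Network.{u', v'}} {r : K.V → ℕ}
    (L : K.IsBlock r) (i : Iso G K) : G.IsBlock fun x => r (i.onV x) := by
  have := Layered.ofIso L i
  rwa [show {x | i.onV x ∈ ({K.s, K.t} : Set K.V)} = {G.s, G.t} by
    ext x
    simp only [Set.mem_ofPred_eq, Set.mem_insert_iff, Set.mem_singleton_iff, ← i.map_s, ← i.map_t,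
      i.onV.injective.eq_iff]] at this

theorem pathNetwork_isBlock (m : ℕ) : (pathNetwork m).IsBlock Fin.val where
  s_ne_t h := by simpa [pathNetwork] using congrArg Fin.val h
  lt e := Nat.lt_succ_self e.1
  s_mem := .inl rfl
  t_mem := .inr rfl
  s_le x := Nat.zero_le x.1
  le_t x := Nat.le_of_lt_succ x.2
  eq_of_rank h _ x hx := Fin.ext hx
  le_of_lt h _ e he := he
  exists_in x hx := Fin.exists_succ_eq.2 hx
  exists_out x hx := Fin.exists_castSucc_eq.2 hx
  in_unique e f _ h := Fin.succ_injective _ h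
  out_unique e f _ h := Fin.castSucc_injective _ h

theorem IsSimplePath.exists_isBlock {G : Network.{u, v}} (h : G.IsSimplePath) :
    ∃ r, G.IsBlock r := by
  obtain ⟨m, ⟨i⟩⟩ := h
  exact ⟨_, (pathNetwork_isBlock m).ofIso i⟩

theorem Layered.s_lt_t {G : Network.{u, v}} {H : Set G.V} {r : G.V → ℕ} (L : G.Layered H r) :
    r G.s < r G.t :=
  (L.s_le _).lt_of_ne fun h => L.s_ne_t (L.eq_of_rank _ L.t_mem _ h)

section Quot

variable {G K : Network.{u, v}}

/-- The node of the series composition that is represented by `x`. -/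
abbrev series.mk (G K : Network.{u, v}) (x : G.V ⊕ K.V) : (series G K).V := Quot.mk _ x

/-- The node of the parallel composition that is represented by `x`. -/
abbrev parallel.mk (G K : Network.{u, v}) (x : G.V ⊕ K.V) : (parallel G K).V := Quot.mk _ x

theorem series.mk_t : series.mk G K (.inl G.t) = series.mk G K (.inr K.s) :=
  Quot.sound ⟨rfl, rfl⟩

theorem parallel.mk_s : parallel.mk G K (.inl G.s) = parallel.mk G K (.inr K.s) :=
  Quot.sound (.inl ⟨rfl, rfl⟩)

theorem parallel.mk_t : parallel.mk G K (.inl G.t) = parallel.mk G K (.inr K.t) :=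
  Quot.sound (.inr ⟨rfl, rfl⟩)

/-- If `R` relates `a` to nothing, the predicate of being equal to `a` descends to the quotient and
separates the class of `a` from all others. This applies to the nodes that are not glued. -/
theorem eq_of_quot_mk_eq {A : Type*} {R : A → A → Prop} {a x : A} (h : ∀ b, ¬ R a b ∧ ¬ R b a)
    (hx : Quot.mk R x = Quot.mk R a) : x = a := by
  let F : Quot R → Prop := Quot.lift (· = a) fun b c hbc => propext
    ⟨fun hb => absurd (hb ▸ hbc) (h c).1, fun hc => absurd (hc ▸ hbc) (h b).2⟩
  exact (congrArg F hx).mpr (show F (Quot.mk R a) from rfl)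

theorem series.eq_of_mk_inl {a : G.V} (ha : a ≠ G.t) {x : G.V ⊕ K.V}
    (h : series.mk G K x = series.mk G K (.inl a)) : x = .inl a :=
  eq_of_quot_mk_eq (fun b => by simp [ha]) h

theorem series.eq_of_mk_inr {a : K.V} (ha : a ≠ K.s) {x : G.V ⊕ K.V}
    (h : series.mk G K x = series.mk G K (.inr a)) : x = .inr a :=
  eq_of_quot_mk_eq (fun b => by simp [ha]) h

theorem parallel.eq_of_mk_inl {a : G.V} (hs : a ≠ G.s) (ht : a ≠ G.t) {x : G.V ⊕ K.V}
    (h : parallel.mk G K x = parallel.mk G K (.inl a)) : x = .inl a :=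
  eq_of_quot_mk_eq (fun b => by simp [hs, ht]) h

theorem parallel.eq_of_mk_inr {a : K.V} (hs : a ≠ K.s) (ht : a ≠ K.t) {x : G.V ⊕ K.V}
    (h : parallel.mk G K x = parallel.mk G K (.inr a)) : x = .inr a :=
  eq_of_quot_mk_eq (fun b => by simp [hs, ht]) h

/-- Series compositions of layered networks are layered. -/
theorem Layered.series {H₁ : Set G.V} {r₁ : G.V → ℕ} {H₂ : Set K.V} {r₂ : K.V → ℕ}
    (L₁ : G.Layered H₁ r₁) (L₂ : K.Layered H₂ r₂) : ∃ H r, (series G K).Layered H r := by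
  let H : Set (G.series K).V := Quot.lift (Sum.elim (· ∈ H₁) (· ∈ H₂)) (by
    rintro _ _ ⟨rfl, rfl⟩
    exact propext ⟨fun _ => L₂.s_mem, fun _ => L₁.t_mem⟩)
  -- The second ranking is shifted to agree with the first at the glued node; the subtraction loses
  -- nothing, as `K.s` has least rank.
  let r : (G.series K).V → ℕ := Quot.lift (Sum.elim r₁ fun b => r₁ G.t + (r₂ b - r₂ K.s)) (by
    rintro _ _ ⟨rfl, rfl⟩
    simp)
  have hl : ∀ a, series.mk G K (.inl a) ∉ H → a ≠ G.t := by
    rintro a h rfl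
    exact h L₁.t_mem
  have hr : ∀ a, series.mk G K (.inr a) ∉ H → a ≠ K.s := by
    rintro a h rfl
    exact h L₂.s_mem
  have h₁ := L₁.s_lt_t
  have h₂ := L₂.s_lt_t
  refine ⟨H, r, ⟨fun h => ?_, ?_, L₁.s_mem, L₂.t_mem, ?_, ?_, ?_, ?_, ?_, ?_, ?_, ?_⟩⟩
  · have : r₁ G.s = r₁ G.t + (r₂ K.t - r₂ K.s) := congrArg r h
    omega
  · rintro (e | e)
    · exact L₁.lt e
    · have h3 := L₂.lt e
      have h4 := L₂.s_le (K.src e)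
      change r₁ G.t + (r₂ _ - r₂ K.s) < r₁ G.t + (r₂ _ - r₂ K.s)
      omega
  · rintro ⟨a | b⟩
    · exact L₁.s_le a
    · exact h₁.le.trans (Nat.le_add_right _ _)
  · rintro ⟨a | b⟩
    · exact (L₁.le_t a).trans (Nat.le_add_right _ _)
    · have := L₂.le_t b
      change r₁ G.t + (r₂ b - r₂ K.s) ≤ r₁ G.t + (r₂ _ - r₂ K.s)
      omega
  · rintro ⟨a | b⟩ hh ⟨a' | b'⟩ hx
    · exact congrArg (series.mk G K <| .inl ·) (L₁.eq_of_rank a hh a' hx)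
    · replace hx : r₁ G.t + (r₂ b' - r₂ K.s) = r₁ a := hx
      have h3 := L₁.le_t a
      have h4 := L₂.s_le b'
      obtain rfl := L₁.eq_of_rank _ L₁.t_mem a (by omega)
      obtain rfl := L₂.eq_of_rank _ L₂.s_mem b' (by omega)
      exact series.mk_t.symm
    · replace hx : r₁ a' = r₁ G.t + (r₂ b - r₂ K.s) := hx
      have h3 := L₁.le_t a'
      have h4 := L₂.s_le b
      obtain rfl := L₁.eq_of_rank _ L₁.t_mem a' (by omega)
      obtain rfl := L₂.eq_of_rank _ L₂.s_mem b (by omega)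
      exact series.mk_t
    · replace hx : r₁ G.t + (r₂ b' - r₂ K.s) = r₁ G.t + (r₂ b - r₂ K.s) := hx
      have h3 := L₂.s_le b
      have h4 := L₂.s_le b'
      exact congrArg (series.mk G K <| .inr ·) (L₂.eq_of_rank b hh b' (by omega))
  · rintro ⟨a | b⟩ hh (e | e) he
    · exact L₁.le_of_lt a hh e he
    · replace he : r₁ G.t + (r₂ (K.src e) - r₂ K.s) < r₁ a := he
      have := L₁.le_t a
      omega
    · exact (L₁.le_t _).trans (Nat.le_add_right _ _)
    · replace he : r₁ G.t + (r₂ (K.src e) - r₂ K.s) < r₁ G.t + (r₂ b - r₂ K.s) := he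
      have := L₂.le_of_lt b hh e (by omega)
      change r₁ G.t + (r₂ (K.tgt e) - r₂ K.s) ≤ r₁ G.t + (r₂ b - r₂ K.s)
      omega
  · have key : ∀ a, a ≠ G.s → ∃ e, (G.series K).tgt e = series.mk G K (.inl a) := by
      intro a ha
      obtain ⟨e, rfl⟩ := L₁.exists_in a ha
      exact ⟨.inl e, rfl⟩
    rintro ⟨a | b⟩ hx
    · exact key a fun h => hx (congrArg (series.mk G K <| .inl ·) h)
    · by_cases hb : b = K.s
      · obtain ⟨e, he⟩ := key G.t L₁.s_ne_t.symm
        exact ⟨e, he.trans (series.mk_t.trans (congrArg (series.mk G K <| .inr ·) hb.symm))⟩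
      · obtain ⟨e, rfl⟩ := L₂.exists_in b hb
        exact ⟨.inr e, rfl⟩
  · have key : ∀ b, b ≠ K.t → ∃ e, (G.series K).src e = series.mk G K (.inr b) := by
      intro a ha
      obtain ⟨e, rfl⟩ := L₂.exists_out a ha
      exact ⟨.inr e, rfl⟩
    rintro ⟨a | b⟩ hx
    · by_cases ha : a = G.t
      · obtain ⟨e, he⟩ := key K.s L₂.s_ne_t
        exact ⟨e, he.trans (series.mk_t.symm.trans (congrArg (series.mk G K <| .inl ·) ha.symm))⟩
      · obtain ⟨e, rfl⟩ := L₁.exists_out a ha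
        exact ⟨.inl e, rfl⟩
    · exact key b fun h => hx (congrArg (series.mk G K <| .inr ·) h)
  · rintro (e | e) (f | f) he hfe
    · exact congrArg _ (L₁.in_unique e f he (Sum.inl_injective
        (series.eq_of_mk_inl (hl _ he) hfe)))
    · exact absurd (series.eq_of_mk_inl (hl _ he) hfe) Sum.inr_ne_inl
    · exact absurd (series.eq_of_mk_inr (hr _ he) hfe) Sum.inl_ne_inr
    · exact congrArg _ (L₂.in_unique e f he (Sum.inr_injective
        (series.eq_of_mk_inr (hr _ he) hfe)))
  · rintro (e | e) (f | f) he hfe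
    · exact congrArg _ (L₁.out_unique e f he (Sum.inl_injective
        (series.eq_of_mk_inl (hl _ he) hfe)))
    · exact absurd (series.eq_of_mk_inl (hl _ he) hfe) Sum.inr_ne_inl
    · exact absurd (series.eq_of_mk_inr (hr _ he) hfe) Sum.inl_ne_inr
    · exact congrArg _ (L₂.out_unique e f he (Sum.inr_injective
        (series.eq_of_mk_inr (hr _ he) hfe)))

/-- Parallel compositions of blocks are blocks. -/
theorem IsBlock.parallel {r₁ : G.V → ℕ} {r₂ : K.V → ℕ} (L₁ : G.IsBlock r₁) (L₂ : K.IsBlock r₂) :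
    ∃ r, (parallel G K).IsBlock r := by
  classical
  -- A common rank for the glued sinks, above those of all other nodes; both sources get rank 0.
  let M := r₁ G.t + r₂ K.t + 1
  let f₁ : G.V → ℕ := fun a => if a = G.t then M else r₁ a - r₁ G.s
  let f₂ : K.V → ℕ := fun b => if b = K.t then M else r₂ b - r₂ K.s
  have f₁s : f₁ G.s = 0 := by simp [f₁, L₁.s_ne_t]
  have f₂s : f₂ K.s = 0 := by simp [f₂, L₂.s_ne_t]
  have f₁t : f₁ G.t = M := if_pos rfl
  have f₂t : f₂ K.t = M := if_pos rfl
  have f₁M : ∀ a, f₁ a ≤ M := by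
    intro a
    have := L₁.le_t a
    simp only [f₁]
    split_ifs <;> omega
  have f₂M : ∀ a, f₂ a ≤ M := by
    intro a
    have := L₂.le_t a
    simp only [f₂]
    split_ifs <;> omega
  have f₁0 : ∀ a, f₁ a = 0 → a = G.s := by
    intro a ha
    have := L₁.s_le a
    simp only [f₁] at ha
    split_ifs at ha
    exact L₁.eq_of_rank _ L₁.s_mem _ (by omega)
  have f₂0 : ∀ a, f₂ a = 0 → a = K.s := by
    intro a ha
    have := L₂.s_le a
    simp only [f₂] at ha
    split_ifs at ha
    exact L₂.eq_of_rank _ L₂.s_mem _ (by omega)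
  have f₁1 : ∀ a, f₁ a = M → a = G.t := by
    intro a ha
    by_contra h
    have := L₁.le_t a
    simp only [f₁, if_neg h] at ha
    omega
  have f₂1 : ∀ a, f₂ a = M → a = K.t := by
    intro a ha
    by_contra h
    have := L₂.le_t a
    simp only [f₂, if_neg h] at ha
    omega
  let r : (G.parallel K).V → ℕ := Quot.lift (Sum.elim f₁ f₂) (by
    rintro _ _ (⟨rfl, rfl⟩ | ⟨rfl, rfl⟩)
    · exact f₁s.trans f₂s.symm
    · exact f₁t.trans f₂t.symm)
  have rs : r (G.parallel K).s = 0 := f₁s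
  have rt : r (G.parallel K).t = M := f₁t
  have rM : ∀ x, r x ≤ r (G.parallel K).t := by
    rw [rt]
    rintro ⟨a | b⟩
    · exact f₁M a
    · exact f₂M b
  have hl : ∀ a, parallel.mk G K (.inl a) ∉ ({(G.parallel K).s, (G.parallel K).t} : Set (G.parallel K).V) →
      a ∉ ({G.s, G.t} : Set G.V) := by
    rintro a h (rfl | rfl)
    · exact h (.inl rfl)
    · exact h (.inr rfl)
  have hr : ∀ a, parallel.mk G K (.inr a) ∉ ({(G.parallel K).s, (G.parallel K).t} : Set (G.parallel K).V) →
      a ∉ ({K.s, K.t} : Set K.V) := by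
    rintro a h (rfl | rfl)
    · exact h (.inl parallel.mk_s.symm)
    · exact h (.inr parallel.mk_t.symm)
  refine ⟨r, ⟨fun h => ?_, ?_, .inl rfl, .inr rfl, ?_, rM, ?_, ?_, ?_, ?_, ?_, ?_⟩⟩
  · have := congrArg r h
    omega
  · rintro (e | e)
    · change f₁ (G.src e) < f₁ (G.tgt e)
      have h1 := L₁.lt e
      have h2 := L₁.s_le (G.src e)
      have h3 := L₁.le_t (G.tgt e)
      simp only [f₁, if_neg (Layered.src_ne_t L₁ e)]
      split_ifs <;> omega
    · change f₂ (K.src e) < f₂ (K.tgt e)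
      have h1 := L₂.lt e
      have h2 := L₂.s_le (K.src e)
      have h3 := L₂.le_t (K.tgt e)
      simp only [f₂, if_neg (Layered.src_ne_t L₂ e)]
      split_ifs <;> omega
  · intro x
    omega
  · rintro h (rfl | rfl) ⟨a | b⟩ hx
    · exact congrArg (parallel.mk G K <| .inl ·) (f₁0 a (hx.trans rs))
    · exact (congrArg (parallel.mk G K <| .inr ·) (f₂0 b (hx.trans rs))).trans parallel.mk_s.symm
    · exact congrArg (parallel.mk G K <| .inl ·) (f₁1 a (hx.trans rt))
    · exact (congrArg (parallel.mk G K <| .inr ·) (f₂1 b (hx.trans rt))).trans parallel.mk_t.symm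
  · rintro h (rfl | rfl) e he
    · omega
    · exact rM _
  · rintro ⟨a | b⟩ hx
    · obtain ⟨e, rfl⟩ := L₁.exists_in a fun h => hx (congrArg (parallel.mk G K <| .inl ·) h)
      exact ⟨.inl e, rfl⟩
    · obtain ⟨e, rfl⟩ := L₂.exists_in b fun h =>
        hx ((congrArg (parallel.mk G K <| .inr ·) h).trans parallel.mk_s.symm)
      exact ⟨.inr e, rfl⟩
  · rintro ⟨a | b⟩ hx
    · obtain ⟨e, rfl⟩ := L₁.exists_out a fun h => hx (congrArg (parallel.mk G K <| .inl ·) h)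
      exact ⟨.inl e, rfl⟩
    · obtain ⟨e, rfl⟩ := L₂.exists_out b fun h =>
        hx ((congrArg (parallel.mk G K <| .inr ·) h).trans parallel.mk_t.symm)
      exact ⟨.inr e, rfl⟩
  · rintro (e | e) (f | f) he hfe
    · have h := hl _ he
      exact congrArg _ (L₁.in_unique e f h (Sum.inl_injective
        (parallel.eq_of_mk_inl (fun h' => h (.inl h')) (fun h' => h (.inr h')) hfe)))
    · have h := hl _ he
      exact absurd (parallel.eq_of_mk_inl (fun h' => h (.inl h')) (fun h' => h (.inr h')) hfe)
        Sum.inr_ne_inl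
    · have h := hr _ he
      exact absurd (parallel.eq_of_mk_inr (fun h' => h (.inl h')) (fun h' => h (.inr h')) hfe)
        Sum.inl_ne_inr
    · have h := hr _ he
      exact congrArg _ (L₂.in_unique e f h (Sum.inr_injective
        (parallel.eq_of_mk_inr (fun h' => h (.inl h')) (fun h' => h (.inr h')) hfe)))
  · rintro (e | e) (f | f) he hfe
    · have h := hl _ he
      exact congrArg _ (L₁.out_unique e f h (Sum.inl_injective
        (parallel.eq_of_mk_inl (fun h' => h (.inl h')) (fun h' => h (.inr h')) hfe)))
    · have h := hl _ he
      exact absurd (parallel.eq_of_mk_inl (fun h' => h (.inl h')) (fun h' => h (.inr h')) hfe)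
        Sum.inr_ne_inl
    · have h := hr _ he
      exact absurd (parallel.eq_of_mk_inr (fun h' => h (.inl h')) (fun h' => h (.inr h')) hfe)
        Sum.inl_ne_inr
    · have h := hr _ he
      exact congrArg _ (L₂.out_unique e f h (Sum.inr_injective
        (parallel.eq_of_mk_inr (fun h' => h (.inl h')) (fun h' => h (.inr h')) hfe)))

end Quot

theorem _root_.List.foldl_induction {A : Type*} {P Q : A → Prop} {f : A → A → A}
    (h : ∀ a b, P a → Q b → P (f a b)) (l : List A) (a : A) (ha : P a) (hl : ∀ b ∈ l, Q b) :
    P (l.foldl f a) := by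
  induction l generalizing a with
  | nil => exact ha
  | cons b l ih =>
    exact ih _ (h a b ha (hl b (by simp))) fun c hc => hl c (List.mem_cons_of_mem _ hc)

variable {G : Network.{u, v}}

theorem IsParallelPaths.exists_isBlock (h : G.IsParallelPaths) : ∃ r, G.IsBlock r := by
  obtain ⟨P, L, hL, ⟨i⟩⟩ := h
  obtain ⟨r, hr⟩ : ∃ r, (L.foldl Network.parallel P).IsBlock r :=
    List.foldl_induction (P := fun K => ∃ r, K.IsBlock r) (Q := IsSimplePath)
      (fun a b ⟨r, ha⟩ hb => let ⟨r', hb⟩ := hb.exists_isBlock; ha.parallel hb) L P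
      (hL P (by simp)).exists_isBlock fun b hb => hL b (List.mem_cons_of_mem _ hb)
  exact ⟨_, hr.ofIso i⟩

/-- A series of parallel paths is layered. -/
theorem IsSPP.exists_layered (h : G.IsSPP) : ∃ H r, G.Layered H r := by
  obtain ⟨P, L, hL, ⟨i⟩⟩ := h
  obtain ⟨H, r, hr⟩ : ∃ H r, (L.foldl Network.series P).Layered H r :=
    List.foldl_induction (P := fun K => ∃ H r, K.Layered H r) (Q := IsParallelPaths)
      (fun a b ⟨H, r, ha⟩ hb => let ⟨r', hb⟩ := hb.exists_isBlock; ha.series hb) L P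
      (let ⟨r, hr⟩ := (hL P (by simp)).exists_isBlock; ⟨_, r, hr⟩)
      fun b hb => hL b (List.mem_cons_of_mem _ hb)
  exact ⟨_, _, hr.ofIso i⟩

end Network

/-! ### Greedy assignment to capacitated resources with decreasing costs -/

namespace Greedy

open Classical

variable {ι α K : Type*} [LinearOrder K]

/-- The number of elements of `T` that are assigned to `a`. -/
noncomputable def count (T : Finset ι) (f : ι → α) (a : α) : ℕ :=
  (T.filter fun i => f i = a).card

/-- An assignment of `T` to `A` that respects the capacities `k`. -/
def Valid (T : Finset ι) (A : Finset α) (k : α → ℕ) (f : ι → α) : Prop :=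
  (∀ i ∈ T, f i ∈ A) ∧ ∀ a ∈ A, count T f a ≤ k a

theorem count_congr {T : Finset ι} {f g : ι → α} (h : ∀ i ∈ T, f i = g i) (a : α) :
    count T f a = count T g a := by
  unfold count
  congr 1
  exact Finset.filter_congr fun i hi => by rw [h i hi]

theorem count_pos {T : Finset ι} {f : ι → α} {i : ι} (hi : i ∈ T) : 0 < count T f (f i) :=
  Finset.card_pos.2 ⟨i, by simp [hi]⟩

theorem Valid.card_le {T : Finset ι} {A : Finset α} {k : α → ℕ} {f : ι → α} (h : Valid T A k f) :
    T.card ≤ ∑ a ∈ A, k a := by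
  rw [Finset.card_eq_sum_card_fiberwise (f := f) (t := A) h.1]
  exact Finset.sum_le_sum fun a ha => h.2 a ha

theorem exists_initial (key : ι → K) (hkey : key.Injective) (T : Finset ι) (m : ℕ)
    (hm : m ≤ T.card) : ∃ S ⊆ T, S.card = m ∧ ∀ i ∈ S, ∀ j ∈ T, j ∉ S → key i < key j := by
  induction m with
  | zero => exact ⟨∅, by simp, by simp, by simp⟩
  | succ m ih =>
    obtain ⟨S, hST, hS, h⟩ := ih (by omega)
    obtain ⟨j, hj, hmin⟩ := Finset.exists_min_image (T \ S) key (by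
      rw [← Finset.card_pos, Finset.card_sdiff_of_subset hST]
      omega)
    rw [Finset.mem_sdiff] at hj
    refine ⟨insert j S, Finset.insert_subset hj.1 hST, by rw [Finset.card_insert_of_notMem hj.2, hS],
      fun i hi l hl hlS => ?_⟩
    rw [Finset.mem_insert, not_or] at hlS
    rcases Finset.mem_insert.1 hi with rfl | hi
    · exact (hmin l (Finset.mem_sdiff.2 ⟨hl, hlS.2⟩)).lt_of_ne fun h => hlS.1 (hkey h.symm)
    · exact h i hi l hl hlS.2

theorem count_eq_of_sdiff {S T : Finset ι} {f g : ι → α} {b a : α}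
    (hS : ∀ i ∈ S, f i = b) (hg : ∀ i ∈ T \ S, f i = g i) (ha : a ≠ b) :
    count T f a = count (T \ S) g a := by
  rw [← count_congr hg]
  unfold count
  congr 1
  ext i
  simp only [Finset.mem_filter, Finset.mem_sdiff]
  constructor
  · rintro ⟨h1, h2⟩
    exact ⟨⟨h1, fun h => ha (h2.symm.trans (hS i h))⟩, h2⟩
  · rintro ⟨⟨h1, -⟩, h2⟩
    exact ⟨h1, h2⟩

/-- Agents who pick resources with decreasing costs in the order of their priority, each group
filling the currently cheapest resource, end up with an assignment in which nobody gains from a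
change of assignments that keeps those of all agents of higher priority. -/
theorem exists_stable (key : ι → K) (hkey : key.Injective) (w : α → ℕ → ℝ≥0∞)
    (hw : ∀ a, Antitone (w a)) (k : α → ℕ) [Nonempty α] (A : Finset α) (T : Finset ι)
    (hT : T.card ≤ ∑ a ∈ A, k a) :
    ∃ f, Valid T A k f ∧ ∀ j ∈ T, ∀ g, Valid T A k g →
      (∀ i ∈ T, key i < key j → g i = f i) →
        w (f j) (count T f (f j)) ≤ w (g j) (count T g (g j)) := by
  induction hn : A.card generalizing A T with
  | zero =>
    obtain rfl := Finset.card_eq_zero.1 hn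
    obtain rfl : T = ∅ := by simpa using hT
    exact ⟨fun _ => Classical.arbitrary α, ⟨by simp, by simp⟩, by simp⟩
  | succ n ih =>
    rcases T.eq_empty_or_nonempty with rfl | hTne
    · exact ⟨fun _ => Classical.arbitrary α, ⟨by simp, by simp [count]⟩, by simp⟩
    -- Resource `a` never serves more than `min T.card (k a)` agents, so by monotonicity its cost at
    -- that load is the least that it can ever charge. The agents of highest priority fill the
    -- resource where this bound is smallest and cannot do better.
    obtain ⟨b, hb, hmin⟩ := Finset.exists_min_image (A.filter fun a => k a ≠ 0)
      (fun a => w a (min T.card (k a))) (by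
        by_contra h
        rw [Finset.not_nonempty_iff_eq_empty, Finset.filter_eq_empty_iff] at h
        rw [Finset.sum_eq_zero fun a ha => not_not.1 (h ha)] at hT
        exact absurd (Finset.card_pos.2 hTne) (by omega))
    rw [Finset.mem_filter] at hb
    obtain ⟨S, hST, hS, hlt⟩ := exists_initial key hkey T (min T.card (k b)) (min_le_left _ _)
    have hcard := Finset.card_sdiff_of_subset hST
    have hsum := Finset.add_sum_erase A k hb.1
    obtain ⟨f', hf', hopt⟩ := ih (A.erase b) (T \ S) (by omega)
      (by rw [Finset.card_erase_of_mem hb.1]; omega)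
    let f : ι → α := fun i => if i ∈ S then b else f' i
    have hfS : ∀ i ∈ S, f i = b := fun i hi => if_pos hi
    have hfT : ∀ i ∈ T \ S, f i = f' i := fun i hi => if_neg (Finset.mem_sdiff.1 hi).2
    have hfb : count T f b = min T.card (k b) := by
      rw [← hS, count]
      congr 1
      ext i
      rw [Finset.mem_filter]
      constructor
      · rintro ⟨h1, h2⟩
        by_contra h3
        have h4 := Finset.mem_sdiff.2 ⟨h1, h3⟩
        rw [hfT i h4] at h2
        exact Finset.ne_of_mem_erase (hf'.1 i h4) h2
      · exact fun h => ⟨hST h, hfS i h⟩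
    have hfa : ∀ a, a ≠ b → count T f a = count (T \ S) f' a := fun a ha =>
      count_eq_of_sdiff hfS hfT ha
    refine ⟨f, ⟨fun i hi => ?_, fun a ha => ?_⟩, fun j hj g hg hgf => ?_⟩
    · by_cases h : i ∈ S
      · exact (hfS i h).symm ▸ hb.1
      · have h' := Finset.mem_sdiff.2 ⟨hi, h⟩
        exact (hfT i h').symm ▸ Finset.mem_of_mem_erase (hf'.1 i h')
    · by_cases h : a = b
      · exact h ▸ hfb.trans_le (min_le_right _ _)
      · exact (hfa a h).trans_le (hf'.2 a (Finset.mem_erase.2 ⟨h, ha⟩))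
    · by_cases hjS : j ∈ S
      · rw [hfS j hjS, hfb]
        have h1 := hg.2 _ (hg.1 j hj)
        have h2 : 0 < count T g (g j) := count_pos hj
        have h3 : count T g (g j) ≤ T.card := Finset.card_filter_le _ _
        exact (hmin (g j) (Finset.mem_filter.2 ⟨hg.1 j hj, by omega⟩)).trans
          (hw _ (le_min h3 h1))
      · have hjT := Finset.mem_sdiff.2 ⟨hj, hjS⟩
        have hgS : ∀ i ∈ S, g i = b := fun i hi =>
          (hgf i (hST hi) (hlt i hi j hj hjS)).trans (hfS i hi)
        -- As `j` was left over, `b` is full. In `g` all of `S` stays at `b`, so no other agent fits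
        -- there, and `g` restricts to a valid assignment of `T \ S` to the other resources.
        have hkb : S.card = k b := by
          have := Finset.card_pos.2 ⟨j, hjT⟩
          omega
        have hgb : ∀ i ∈ T \ S, g i ≠ b := by
          intro i hi hib
          rw [Finset.mem_sdiff] at hi
          have h1 : insert i S ⊆ T.filter fun i => g i = b := by
            intro l hl
            rcases Finset.mem_insert.1 hl with rfl | hl
            · exact Finset.mem_filter.2 ⟨hi.1, hib⟩
            · exact Finset.mem_filter.2 ⟨hST hl, hgS l hl⟩
          have h2 := Finset.card_le_card h1
          rw [Finset.card_insert_of_notMem hi.2] at h2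
          have h3 : _ ≤ k b := hg.2 b hb.1
          unfold count at h3
          omega
        have hga : ∀ a, a ≠ b → count T g a = count (T \ S) g a := fun a ha =>
          count_eq_of_sdiff hgS (fun _ _ => rfl) ha
        rw [hfT j hjT, hfa _ (Finset.ne_of_mem_erase (hf'.1 j hjT)), hga _ (hgb j hjT)]
        refine hopt j hjT g ⟨fun i hi => Finset.mem_erase.2 ⟨hgb i hi,
          hg.1 i (Finset.mem_sdiff.1 hi).1⟩, fun a ha => ?_⟩ fun i hi hij => ?_
        · rw [← hga a (Finset.ne_of_mem_erase ha)]
          exact hg.2 a (Finset.mem_of_mem_erase ha)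
        · rw [hgf i (Finset.mem_sdiff.1 hi).1 hij, hfT i hi]

end Greedy

/-! ### Chains of a layered network and the paths through them -/

namespace Network

variable {G : Network.{u, v}}

/-- `root e` is the first edge of the chain of `e`, where chains start at nodes of `S`. -/
structure IsRoot (G : Network.{u, v}) (S : Set G.V) (root : G.E → G.E) : Prop where
  of_mem : ∀ e, G.src e ∈ S → root e = e
  of_notMem : ∀ e f, G.src e ∉ S → G.tgt f = G.src e → root e = root f

namespace Layered

variable {H : Set G.V} {r : G.V → ℕ} (L : G.Layered H r)
include L

theorem exists_pred {e : G.E} {S : Set G.V} (hS : H ⊆ S) (he : G.src e ∉ S) :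
    ∃ f, G.tgt f = G.src e :=
  L.exists_in _ fun h => he (hS (h ▸ L.s_mem))

/-- Trace backwards: outside `S` the incoming edge is unique, and ranks decrease. -/
theorem exists_root {S : Set G.V} (hS : H ⊆ S) : ∃ root, G.IsRoot S root := by
  classical
  let wf : WellFounded fun f e : G.E => r (G.src f) < r (G.src e) := InvImage.wf _ wellFounded_lt
  have hp : ∀ {e}, G.src e ∉ S → ∃ f, G.tgt f = G.src e := L.exists_pred hS
  let root : G.E → G.E := wf.fix fun e ih => if h : G.src e ∈ S then e else
    ih (hp h).choose ((L.lt _).trans_eq (congrArg r (hp h).choose_spec))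
  refine ⟨root, fun e he => ?_, fun e f he hf => ?_⟩
  · simp only [root]
    rw [wf.fix_eq, dif_pos he]
  · have h1 : root e = root (hp he).choose := by
      simp only [root]
      rw [wf.fix_eq, dif_neg he]
    have h2 : f = (hp he).choose :=
      L.in_unique _ _ (by rw [(hp he).choose_spec]; exact fun h => he (hS h))
        (hf.trans (hp he).choose_spec.symm)
    rw [h1, ← h2]

section Root

variable {S : Set G.V} (hS : H ⊆ S) {root : G.E → G.E} (hr : G.IsRoot S root)
include hS hr

/-- Induction along chains. -/
theorem root_induction {P : G.E → Prop} (h₁ : ∀ e, G.src e ∈ S → P e)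
    (h₂ : ∀ e f, G.src e ∉ S → G.tgt f = G.src e → root e = root f → P f → P e) (e : G.E) :
    P e := by
  induction hn : r (G.src e) using Nat.strong_induction_on generalizing e with
  | _ n ih =>
    by_cases he : G.src e ∈ S
    · exact h₁ e he
    · obtain ⟨f, hf⟩ := L.exists_pred hS he
      exact h₂ e f he hf (hr.of_notMem e f he hf)
        (ih (r (G.src f)) (by rw [← hn, ← hf]; exact L.lt f) f rfl)

theorem src_root_mem (e : G.E) : G.src (root e) ∈ S := by
  induction e using L.root_induction hS hr with
  | h₁ e he => rwa [hr.of_mem e he]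
  | h₂ e f he hf hef ih => rwa [hef]

/-- No edge jumps over `w`, and a chain stops when it meets `w`, since `w` lies in `S`. -/
theorem tgt_le_of_root_lt {w : G.V} (hw : w ∈ H) (e : G.E) (h : r (G.src (root e)) < r w) :
    r (G.tgt e) ≤ r w := by
  induction e using L.root_induction hS hr with
  | h₁ e he =>
    rw [hr.of_mem e he] at h
    exact L.le_of_lt w hw e h
  | h₂ e f he hf hef ih =>
    rw [hef] at h
    refine L.le_of_lt w hw e (lt_of_le_of_ne (hf ▸ ih h) fun h' => he (hS ?_))
    exact (L.eq_of_rank w hw _ h').symm ▸ hw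

theorem root_mem_path {x y : G.V} (hx : x ∈ S) {p : List G.E} (hp : G.IsWalk x p y) (e : G.E)
    (he : e ∈ p) : root e ∈ p := by
  induction e using L.root_induction hS hr with
  | h₁ e he' => rwa [hr.of_mem e he']
  | h₂ e f he' hf hef ih =>
    obtain ⟨g, hg, hgs⟩ := IsWalk.exists_pred (hp.src_mem_nodes he) fun h => he' (h ▸ hx)
    obtain rfl := L.in_unique f g (by rw [hf]; exact fun h => he' (hS h)) (hgs.trans hf.symm)
    exact hef ▸ ih hg

/-- The nodes inside the chain lie before `w`, so the path cannot end there, and each of them has a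
single exit. -/
theorem mem_path_of_root_mem {x y w : G.V} {p : List G.E} (hp : G.IsWalk x p y)
    (hw : w ∈ H) (e : G.E) (h₁ : r (G.src (root e)) < r w) (h₂ : r w ≤ r y)
    (he : root e ∈ p) : e ∈ p := by
  induction e using L.root_induction hS hr with
  | h₁ e he' => rwa [hr.of_mem e he'] at he
  | h₂ e f he' hf hef ih =>
    have hfp := ih (hef ▸ h₁) (hef ▸ he)
    obtain ⟨g, hg, hgs⟩ := hp.exists_succ (tgt_mem_nodes hfp) fun h => by
      have h3 := L.tgt_le_of_root_lt hS hr hw e h₁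
      have h4 := L.lt e
      rw [← h, hf] at h₂
      omega
    rwa [← L.out_unique e g (fun h => he' (hS h)) (hgs.trans hf)]

end Root

/-- The last part of a path, beyond the last hub, is determined by the sink. -/
theorem mem_path_of_mem_path {x y h : G.V} {p q : List G.E} (hp : G.IsWalk x p y)
    (hq : G.IsWalk x q y) (hxh : r x ≤ r h) (hno : ∀ w ∈ H, r h < r w → r y < r w) {e : G.E}
    (he : e ∈ p) (hhe : r h < r (G.tgt e)) : e ∈ q := by
  -- Induction backwards from the sink: heads of rank above `h` are not in `H`, so the edge by which
  -- they are entered is unique.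
  induction hn : r y - r (G.tgt e) using Nat.strong_induction_on generalizing e with
  | _ n ih =>
    have hle := (L.rank_le_of_mem hp (tgt_mem_nodes he)).2
    have hx : G.tgt e ≠ x := fun h' => by rw [h'] at hhe; omega
    have hH : G.tgt e ∉ H := fun h' => absurd (hno _ h' hhe) (not_lt.2 hle)
    by_cases hy : G.tgt e = y
    · obtain ⟨f, hf, hft⟩ := IsWalk.exists_pred hq.end_mem_nodes (hy ▸ hx)
      rwa [← L.in_unique e f hH (hft.trans hy.symm)]
    · obtain ⟨g, hg, hgs⟩ := hp.exists_succ (tgt_mem_nodes he) hy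
      have h1 := L.lt g
      have h2 := (L.rank_le_of_mem hp (tgt_mem_nodes hg)).2
      rw [hgs] at h1
      have hgq := ih (r y - r (G.tgt g)) (by omega) hg (hhe.trans h1) rfl
      obtain ⟨f, hf, hft⟩ := IsWalk.exists_pred (hq.src_mem_nodes hgq) (hgs ▸ hx)
      rwa [← L.in_unique e f hH (hft.trans hgs)]

theorem mem_nodes_of_rank {x y w : G.V} {p : List G.E} (hp : G.IsWalk x p y) (hw : w ∈ H)
    (h₁ : r x ≤ r w) (h₂ : r w ≤ r y) : w ∈ G.nodes x p := by
  induction p generalizing x with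
  | nil =>
    obtain rfl : x = y := hp
    rw [L.eq_of_rank w hw x (le_antisymm h₁ h₂)]
    exact start_mem_nodes _ _
  | cons e p ih =>
    obtain ⟨rfl, hp⟩ := hp
    rcases h₁.eq_or_lt with h | h
    · rw [L.eq_of_rank w hw _ h]
      exact start_mem_nodes _ _
    · rw [nodes_cons]
      exact List.mem_cons_of_mem _ (ih hp (L.le_of_lt w hw e h))

/-- Local choices that keep `y` reachable assemble into a walk, since the rank increases but never
exceeds that of `y`. -/
theorem exists_walk_of_step {y : G.V} {P : G.E → Prop}
    (h : ∀ c, c ≠ y → G.Reach c y → ∃ e, G.src e = c ∧ G.Reach (G.tgt e) y ∧ P e) (c : G.V)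
    (hc : G.Reach c y) : ∃ p, G.IsWalk c p y ∧ ∀ e ∈ p, P e := by
  induction hn : r y - r c using Nat.strong_induction_on generalizing c with
  | _ n ih =>
    by_cases hcy : c = y
    · exact ⟨[], hcy, by simp⟩
    · obtain ⟨e, rfl, h1, h2⟩ := h c hcy hc
      have h3 := L.lt e
      obtain ⟨q, hq, -⟩ := h1
      have h4 := (L.rank_le_of_mem hq (start_mem_nodes _ _)).2
      obtain ⟨p, hp, hP⟩ := ih (r y - r (G.tgt e)) (by omega) _ hq.reach rfl
      exact ⟨e :: p, ⟨rfl, hp⟩, by simpa [h2] using hP⟩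

end Layered

/-! ### Single-source games on layered networks -/

namespace Layered

open Classical Greedy

variable {n : ℕ} {H : Set G.V} {r : G.V → ℕ}

/-- The agents with sinks `y` that have to pass from `h` to the next hub. -/
noncomputable def through (r : G.V → ℕ) (H : Set G.V) (x : G.V) (y : Fin n → G.V) (h : G.V) :
    Finset (Fin n) :=
  Finset.univ.filter fun i => r x ≤ r h ∧ ∃ w ∈ H, r h < r w ∧ r w ≤ r (y i)

/-- The number of paths that contain `e`. -/
noncomputable def pathLoad (P : Fin n → List G.E) (e : G.E) : ℕ :=
  (Finset.univ.filter fun i => e ∈ P i).card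

/-- The edge by which the `i`-th path leaves `h`. -/
noncomputable def choice [Nonempty G.E] (P : Fin n → List G.E) (h : G.V) (i : Fin n) : G.E :=
  Classical.epsilon fun a => a ∈ P i ∧ G.src a = h

/-- The number of agents that pass the edge `e` although they do not have to choose between the
chains of its block, according to the reference paths `P`. -/
noncomputable def forced (r : G.V → ℕ) (H : Set G.V) (x : G.V) (y : Fin n → G.V)
    (root : G.E → G.E) (P : Fin n → List G.E) (e : G.E) : ℕ :=
  (Finset.univ.filter fun i => i ∉ through r H x y (G.src (root e)) ∧ e ∈ P i).card

theorem mem_through {x h : G.V} {y : Fin n → G.V} {i : Fin n} :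
    i ∈ through r H x y h ↔ r x ≤ r h ∧ ∃ w ∈ H, r h < r w ∧ r w ≤ r (y i) := by
  simp [through]

section

variable (L : G.Layered H r) {x : G.V} {y : Fin n → G.V} {root : G.E → G.E}
  (hr : G.IsRoot (insert x H) root)
include L

theorem choice_spec [Nonempty G.E] {P : Fin n → List G.E} (hP : ∀ i, G.IsWalk x (P i) (y i))
    {h : G.V} (hh : h ∈ insert x H) {i : Fin n} (hi : i ∈ through r H x y h) :
    choice P h i ∈ P i ∧ G.src (choice P h i) = h := by
  obtain ⟨hx, w, hw, h1, h2⟩ := mem_through.1 hi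
  have hmem : h ∈ G.nodes x (P i) := by
    rcases hh with rfl | hh
    · exact start_mem_nodes _ _
    · exact L.mem_nodes_of_rank (hP i) hh hx (h1.le.trans h2)
  obtain ⟨e, he, hes⟩ := (hP i).exists_succ hmem fun h' => by
    rw [← h'] at h2
    omega
  exact Classical.epsilon_spec (p := fun a => a ∈ P i ∧ G.src a = h) ⟨e, he, hes⟩

theorem mem_iff_eq_choice [Nonempty G.E] {P : Fin n → List G.E}
    (hP : ∀ i, G.IsWalk x (P i) (y i)) {h : G.V} (hh : h ∈ insert x H) {i : Fin n}
    (hi : i ∈ through r H x y h) {a : G.E} (ha : G.src a = h) :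
    a ∈ P i ↔ choice P h i = a := by
  obtain ⟨h1, h2⟩ := L.choice_spec hP hh hi
  constructor
  · exact fun h3 => (L.isPath (hP i)).eq_of_src h1 h3 (h2.trans ha.symm)
  · rintro rfl
    exact h1

include hr

/-- An agent who has to cross the block uses a chain entirely or not at all. -/
theorem mem_iff_root_mem {P : Fin n → List G.E} (hP : ∀ i, G.IsWalk x (P i) (y i)) {e : G.E}
    {i : Fin n} (hi : i ∈ through r H x y (G.src (root e))) : e ∈ P i ↔ root e ∈ P i := by
  obtain ⟨-, w, hw, h1, h2⟩ := mem_through.1 hi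
  exact ⟨L.root_mem_path (Set.subset_insert _ _) hr (Set.mem_insert _ _) (hP i) e,
    L.mem_path_of_root_mem (Set.subset_insert _ _) hr (hP i) hw e h1 h2⟩

/-- If the path enters the block without having to cross it, no separating node follows up to the
sink, and this last part is determined by the sink alone. -/
theorem mem_of_notMem_through {P Q : Fin n → List G.E} (hP : ∀ i, G.IsWalk x (P i) (y i))
    (hQ : ∀ i, G.IsWalk x (Q i) (y i)) {e : G.E} {i : Fin n}
    (hi : i ∉ through r H x y (G.src (root e))) (he : e ∈ P i) : e ∈ Q i := by
  have hroot := L.root_mem_path (Set.subset_insert _ _) hr (Set.mem_insert _ _) (hP i) e he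
  have hx := (L.rank_le_of_mem (hP i) ((hP i).src_mem_nodes hroot)).1
  refine L.mem_path_of_mem_path (hP i) (hQ i) hx (fun w hw h1 => ?_) he ?_
  · by_contra h2
    exact hi (mem_through.2 ⟨hx, w, hw, h1, not_lt.1 h2⟩)
  · refine lt_of_le_of_lt ?_ (L.lt e)
    clear hi he hroot hx
    induction e using L.root_induction (Set.subset_insert _ _) hr with
    | h₁ e he => rw [hr.of_mem e he]
    | h₂ e f he hf hef ih =>
      rw [hef, ← hf]
      exact ih.trans (L.lt f).le

theorem mem_iff_of_notMem_through {P Q : Fin n → List G.E} (hP : ∀ i, G.IsWalk x (P i) (y i))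
    (hQ : ∀ i, G.IsWalk x (Q i) (y i)) {e : G.E} {i : Fin n}
    (hi : i ∉ through r H x y (G.src (root e))) : e ∈ P i ↔ e ∈ Q i :=
  ⟨L.mem_of_notMem_through hr hP hQ hi, L.mem_of_notMem_through hr hQ hP hi⟩

/-- The load of an edge is made up of a fixed part and of the agents who choose its chain. -/
theorem pathLoad_eq [Nonempty G.E] {P Q : Fin n → List G.E} (hP : ∀ i, G.IsWalk x (P i) (y i))
    (hQ : ∀ i, G.IsWalk x (Q i) (y i)) (e : G.E) :
    pathLoad P e = forced r H x y root Q e +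
      count (through r H x y (G.src (root e))) (choice P (G.src (root e))) (root e) := by
  have hmem := L.src_root_mem (Set.subset_insert _ _) hr e
  rw [pathLoad, ← Finset.card_filter_add_card_filter_not
    (fun i => i ∈ through r H x y (G.src (root e))), add_comm, Finset.filter_filter,
    Finset.filter_filter]
  congr 1
  · unfold forced
    congr 1
    ext i
    simp only [Finset.mem_filter, Finset.mem_univ, true_and]
    rw [and_comm]
    exact and_congr_right fun hi => L.mem_iff_of_notMem_through hr hP hQ hi
  · unfold count
    congr 1
    ext i
    simp only [Finset.mem_filter, Finset.mem_univ, true_and]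
    rw [and_comm]
    refine and_congr_right fun hi => ?_
    rw [L.mem_iff_root_mem hr hP hi, L.mem_iff_eq_choice hP hmem hi rfl]

end

end Layered

end Network

/-! ### Costs by blocks and existence of strong equilibria -/

namespace Network

variable {G : Network.{u, v}}

namespace Layered

open Classical Greedy

variable {n : ℕ} {H : Set G.V} {r : G.V → ℕ}

/-- The cost of the `j`-th of the paths `P` if edge costs `c` are shared equally. -/
noncomputable def pathCost [Fintype G.E] (c : G.E → ℝ≥0∞) (P : Fin n → List G.E) (j : Fin n) :
    ℝ≥0∞ :=
  ∑ e, if e ∈ P j then c e / pathLoad P e else 0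

/-- The cost of the chain with first edge `a` to one of `m` agents who choose it, if the edges
have the fixed loads `F`. -/
noncomputable def chainCost [Fintype G.E] (c : G.E → ℝ≥0∞) (root : G.E → G.E) (F : G.E → ℕ)
    (a : G.E) (m : ℕ) : ℝ≥0∞ :=
  ∑ e with root e = a, c e / ((F e + m : ℕ) : ℝ≥0∞)

theorem chainCost_antitone [Fintype G.E] (c : G.E → ℝ≥0∞) (root : G.E → G.E) (F : G.E → ℕ)
    (a : G.E) : Antitone (chainCost c root F a) := fun m m' h =>
  Finset.sum_le_sum fun e _ => ENNReal.div_le_div_left (by exact_mod_cast by omega) _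

/-- The number of additional agents that the chain with first edge `a` can take. -/
noncomputable def chainCap (n : ℕ) (cap : G.E → ℕ) (root : G.E → G.E) (F : G.E → ℕ) (a : G.E) : ℕ :=
  Nat.findGreatest (fun m => ∀ e, root e = a → F e + m ≤ cap e) n

theorem le_chainCap {cap : G.E → ℕ} {root : G.E → G.E} {F : G.E → ℕ} {a : G.E} {m : ℕ}
    (hm : m ≤ n) (h : ∀ e, root e = a → F e + m ≤ cap e) : m ≤ chainCap n cap root F a :=
  Nat.le_findGreatest hm h

theorem add_chainCap_le {cap : G.E → ℕ} {root : G.E → G.E} {F : G.E → ℕ} (h : ∀ e, F e ≤ cap e)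
    (e : G.E) : F e + chainCap n cap root F (root e) ≤ cap e :=
  Nat.findGreatest_spec (P := fun m => ∀ e', root e' = root e → F e' + m ≤ cap e')
    (Nat.zero_le n) (fun e' _ => h e') e rfl

section

variable (L : G.Layered H r) {x : G.V} {y : Fin n → G.V} {root : G.E → G.E}
  (hr : G.IsRoot (insert x H) root)
include L hr

/-- Feasibility as seen from one block: each edge of a chain carries the forced load and all who
choose the chain. The cutoff `n` in `chainCap` is harmless, as there are only `n` agents. -/
theorem valid_choice [Fintype G.E] [Nonempty G.E] {P Q : Fin n → List G.E}
    (hP : ∀ i, G.IsWalk x (P i) (y i)) (hQ : ∀ i, G.IsWalk x (Q i) (y i)) {cap : G.E → ℕ}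
    (hcap : ∀ e, pathLoad Q e ≤ cap e) {h : G.V} (hh : h ∈ insert x H) :
    Valid (through r H x y h) (Finset.univ.filter fun a => G.src a = h)
      (chainCap n cap root (forced r H x y root P)) (choice Q h) := by
  refine ⟨fun i hi => by simpa using (L.choice_spec hQ hh hi).2, fun a ha => ?_⟩
  have ha' : G.src a = h := by simpa using ha
  refine le_chainCap ((Finset.card_filter_le _ _).trans ((Finset.card_le_univ _).trans
    (by simp))) fun e he => ?_
  have h1 := L.pathLoad_eq hr hQ hP e
  rw [he, ha'] at h1
  exact h1 ▸ hcap e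

/-- The costs of agent `j` in the block that starts at `h`. -/
theorem block_cost [Fintype G.E] [Nonempty G.E] {P Q : Fin n → List G.E}
    (hP : ∀ i, G.IsWalk x (P i) (y i)) (hQ : ∀ i, G.IsWalk x (Q i) (y i)) (c : G.E → ℝ≥0∞)
    {h : G.V} (hh : h ∈ insert x H) {j : Fin n} (hj : j ∈ through r H x y h) :
    (∑ e with G.src (root e) = h, if e ∈ Q j then c e / pathLoad Q e else 0) =
      chainCost c root (forced r H x y root P) (choice Q h j)
        (count (through r H x y h) (choice Q h) (choice Q h j)) := by
  rw [← Finset.sum_filter, chainCost, Finset.filter_filter]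
  refine Finset.sum_congr ?_ fun e he => ?_
  · ext e
    simp only [Finset.mem_filter, Finset.mem_univ, true_and]
    constructor
    · rintro ⟨rfl, he⟩
      rw [L.mem_iff_root_mem hr hQ hj, L.mem_iff_eq_choice hQ hh hj rfl] at he
      exact he.symm
    · intro he
      obtain rfl : G.src (root e) = h := he ▸ (L.choice_spec hQ hh hj).2
      refine ⟨rfl, ?_⟩
      rw [L.mem_iff_root_mem hr hQ hj, L.mem_iff_eq_choice hQ hh hj rfl]
      exact he.symm
  · have he' : root e = choice Q h j := by simpa using he
    have h1 := L.pathLoad_eq hr hQ hP e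
    rw [he', (L.choice_spec hQ hh hj).2] at h1
    rw [h1]

end

/-- A feasible family of paths from a common source of a layered network can be replaced by one
with the same sinks that is stable under deviations of coalitions. -/
theorem exists_stable_paths [Fintype G.V] [Fintype G.E] (L : G.Layered H r) {x : G.V}
    {y : Fin n → G.V} {cap : G.E → ℕ} (c : G.E → ℝ≥0∞) {P : Fin n → List G.E}
    (hP : ∀ i, G.IsWalk x (P i) (y i)) (hPcap : ∀ e, pathLoad P e ≤ cap e) :
    ∃ Q : Fin n → List G.E, (∀ i, G.IsWalk x (Q i) (y i)) ∧ (∀ e, pathLoad Q e ≤ cap e) ∧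
      ∀ C : Finset (Fin n), C.Nonempty → ∀ R : Fin n → List G.E,
        (∀ i, G.IsWalk x (R i) (y i)) → (∀ e, pathLoad R e ≤ cap e) → (∀ i ∉ C, R i = Q i) →
          ∃ j ∈ C, pathCost c Q j ≤ pathCost c R j := by
  obtain ⟨e₀, -⟩ := L.exists_in _ L.s_ne_t.symm
  have : Nonempty G.E := ⟨e₀⟩
  -- The source may lie inside a chain; adding it to `H` lets a new chain start there.
  obtain ⟨root, hr⟩ := L.exists_root (Set.subset_insert x H)
  -- Farther sinks come first, ties being broken by the index. This order serves for all blocks at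
  -- once.
  let key : Fin n → ℕᵒᵈ ×ₗ Fin n := fun i => toLex (OrderDual.toDual (r (y i)), i)
  have hkey : key.Injective := fun i j h => congrArg (fun z => (ofLex z).2) h
  have hkey' : ∀ i j, r (y j) < r (y i) → key i < key j := fun i j h =>
    Prod.Lex.toLex_lt_toLex.2 (.inl h)
  let F := forced r H x y root P
  let T := through r H x y
  let A : G.V → Finset G.E := fun h => Finset.univ.filter fun a => G.src a = h
  let k := chainCap n cap root F
  have hex : ∀ h, ∃ f, h ∈ insert x H → Valid (T h) (A h) k f ∧ ∀ j ∈ T h, ∀ g,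
      Valid (T h) (A h) k g → (∀ i ∈ T h, key i < key j → g i = f i) →
        chainCost c root F (f j) (count (T h) f (f j)) ≤
          chainCost c root F (g j) (count (T h) g (g j)) := by
    intro h
    by_cases hh : h ∈ insert x H
    · obtain ⟨f, hf⟩ := exists_stable key hkey _ (chainCost_antitone c root F) k (A h) (T h)
        (L.valid_choice hr hP hP hPcap hh).card_le
      exact ⟨f, fun _ => hf⟩
    · exact ⟨fun _ => e₀, fun h' => absurd h' hh⟩
  choose f hf using hex
  have hstep : ∀ i, ∃ p, G.IsWalk x p (y i) ∧
      ∀ e ∈ p, G.src e ∈ insert x H → i ∈ T (G.src e) → e = f (G.src e) i := by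
    intro i
    refine L.exists_walk_of_step (fun h hh hreach => ?_) x (hP i).reach
    by_cases hi : h ∈ insert x H ∧ i ∈ T h
    · obtain ⟨h1, h2⟩ := hi
      have hsrc : G.src (f h i) = h := by simpa [A] using (hf h h1).1.1 i h2
      obtain ⟨h3, w, hw, h4, h5⟩ := mem_through.1 h2
      refine ⟨f h i, hsrc, ?_, fun _ _ => by rw [hsrc]⟩
      -- The chosen edge cannot miss the sink: its head is not beyond `w`, so it leads to `w`, and
      -- from there the old path `P i` leads to `y i`.
      obtain ⟨q, hq⟩ := L.reach_t (G.tgt (f h i))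
      have h6 : w ∈ G.nodes _ q := L.mem_nodes_of_rank hq hw
        (L.le_of_lt w hw _ (hsrc.symm ▸ h4)) (L.le_t w)
      obtain ⟨q₁, -, -, hq₁, -⟩ := hq.split h6
      obtain ⟨-, p₂, -, -, hp₂⟩ := (hP i).split (L.mem_nodes_of_rank (hP i) hw (h3.trans h4.le) h5)
      exact hq₁.reach.trans hp₂.reach
    · rcases hreach.eq_or_first with h1 | ⟨e, rfl, h1⟩
      · exact absurd h1 hh
      · exact ⟨e, rfl, h1, fun h2 h3 => absurd ⟨h2, h3⟩ hi⟩
  choose Q hQ hQf using hstep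
  have hchoice : ∀ h ∈ insert x H, ∀ i ∈ T h, choice Q h i = f h i := by
    intro h hh i hi
    obtain ⟨h1, h2⟩ := L.choice_spec hQ hh hi
    have h3 := hQf i _ h1
    rw [h2] at h3
    exact h3 hh hi
  refine ⟨Q, hQ, fun e => ?_, fun C hC R hR hRcap hRQ => ?_⟩
  · have hmem := L.src_root_mem (Set.subset_insert _ _) hr e
    have h1 := (hf _ hmem).1.2 (root e) (by simp [A])
    rw [← count_congr (hchoice _ hmem)] at h1
    have h2 : ∀ e', F e' ≤ cap e' := fun e' => by
      have := L.pathLoad_eq hr hP hP e'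
      exact (Nat.le_add_right _ _).trans (this ▸ hPcap e')
    rw [L.pathLoad_eq hr hQ hP e]
    exact (Nat.add_le_add_left h1 _).trans (add_chainCap_le h2 e)
  -- The member of highest priority does not gain in any block; in blocks that she crosses this is
  -- greedy stability.
  · obtain ⟨j, hj, hmin⟩ := Finset.exists_min_image C key hC
    refine ⟨j, hj, ?_⟩
    have hbefore : ∀ i, key i < key j → R i = Q i := fun i hi =>
      hRQ i fun h => absurd (hmin i h) (not_le.2 hi)
    unfold pathCost
    rw [← Finset.sum_fiberwise Finset.univ (fun e => G.src (root e)),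
      ← Finset.sum_fiberwise Finset.univ (fun e => G.src (root e)) fun e =>
        if e ∈ R j then c e / pathLoad R e else 0]
    refine Finset.sum_le_sum fun h _ => ?_
    by_cases hh : h ∈ insert x H
    · by_cases hjT : j ∈ T h
      · rw [L.block_cost hr hP hQ c hh hjT, L.block_cost hr hP hR c hh hjT,
          count_congr (hchoice h hh), hchoice h hh j hjT]
        refine (hf h hh).2 j hjT _ (L.valid_choice hr hP hR hRcap hh) fun i hi hij => ?_
        rw [← hchoice h hh i hi, choice, choice, hbefore i hij]
      · refine Finset.sum_le_sum fun e he => ?_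
        obtain rfl : G.src (root e) = h := by simpa using he
        -- In a block that `j` does not cross, whoever does cross it has a farther sink, hence
        -- higher priority, and does not deviate. So neither the loads nor the edges of `j` change
        -- there.
        have hload : pathLoad Q e = pathLoad R e := by
          rw [L.pathLoad_eq hr hQ hP, L.pathLoad_eq hr hR hP]
          congr 1
          refine count_congr (fun i hi => ?_) _
          obtain ⟨h1, w, hw, h2, h3⟩ := mem_through.1 hi
          have h4 : r (y j) < r w := by
            by_contra h4
            exact hjT (mem_through.2 ⟨h1, w, hw, h2, not_lt.1 h4⟩)
          rw [choice, choice, hbefore i (hkey' i j (h4.trans_le h3))]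
        rw [hload, if_congr (L.mem_iff_of_notMem_through hr hQ hR hjT) rfl rfl]
    · rw [Finset.filter_false_of_mem fun e _ (h' : G.src (root e) = h) =>
        hh (h' ▸ L.src_root_mem (Set.subset_insert _ _) hr e)]
      simp

/-- Layered networks admit strong equilibria in single-source games. -/
theorem admits [Finite G.V] [Finite G.E] (L : G.Layered H r) :
    G.AdmitsSEInSingleSourceGames := by
  have := Fintype.ofFinite G.V
  have := Fintype.ofFinite G.E
  rintro n Δ ⟨x, hx⟩ ⟨ρ, hρ⟩
  have hwalk : ∀ (σ : Δ.Profile) i, G.IsWalk x (σ i).1 (Δ.sink i) := fun σ i => hx i ▸ (σ i).2.1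
  have hload : ∀ (σ : Δ.Profile) e, Δ.load σ e = pathLoad (fun i => (σ i).1) e := by
    intro σ e
    unfold Game.load pathLoad
    congr
  have hcost : ∀ σ : Δ.Profile, Δ.Feasible σ → ∀ j, Δ.agentCost σ j =
      pathCost (fun e => (Δ.cost e : ℝ≥0∞)) (fun i => (σ i).1) j := by
    intro σ hσ j
    rw [Game.agentCost, if_pos hσ, (σ j).2.edges_nodup.sum_map_eq_ite Finset.univ _
      fun e _ he => absurd (Finset.mem_univ e) he]
    refine Finset.sum_congr rfl fun e _ => ?_
    rw [hload]
  obtain ⟨Q, hQ, hQcap, hstable⟩ := L.exists_stable_paths (cap := Δ.cap)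
    (fun e => (Δ.cost e : ℝ≥0∞)) (hwalk ρ) fun e => hload ρ e ▸ hρ e
  let σ : Δ.Profile := fun i => ⟨Q i, (hx i).symm ▸ L.isPath (hQ i)⟩
  have hσ : Δ.Feasible σ := fun e => (hload σ e).trans_le (hQcap e)
  refine ⟨σ, fun C hC τ hτ => ?_⟩
  by_cases hτf : Δ.Feasible τ
  · obtain ⟨j, hj, hle⟩ := hstable C hC (fun i => (τ i).1) (hwalk τ)
      (fun e => hload τ e ▸ hτf e) fun i hi => congrArg Subtype.val (hτ i hi)
    exact ⟨j, hj, by rw [hcost σ hσ, hcost τ hτf]; exact hle⟩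
  · obtain ⟨j, hj⟩ := hC
    exact ⟨j, hj, by rw [Game.agentCost, Game.agentCost, if_neg hτf]; exact le_top⟩

end Layered

end Network

end CCS

theorem mainTheorem5 (G : CCS.Network.{u, v}) [Finite G.V] [Finite G.E]
    (hG : G.IsTwoTerminal) :
    G.AdmitsSEInSingleSourceGames ↔ G.IsSPP := by
  constructor
  · intro h
    obtain ⟨H, r, L⟩ := h.exists_layered hG
    exact L.isSPP
  · intro h
    obtain ⟨H, r, L⟩ := h.exists_layered
    exact L.admits
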